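/- Let $X,\eta,Y$ be random variables on a probability space with values in $\mathbb R^d,\mathbb R^{\tilde d},\mathbb R^{\tilde d}$, with $Y=F(X)+\eta$ for a measurable $F:\mathbb R^d\to\mathbb R^{\tilde d}$, and let $Z$ be an $\mathbb R^d$-valued random variable with Lebesgue density $p_Z$. All conditional laws are regular conditional distributions. A path $(X_0,\dots,X_T)$ of $\mathbb R^d$-valued random variables on the same space is a *conditional stochastic normalizing flow conditioned to $Y$* if for $P_Y$-a.e. $y$ every $P_{X_t|Y=y}$ ($0\le t\le T$) has a strictly positive Lebesgue density $p_{X_t^y}$, and there are Markov kernels $\mathcal K_t$ from $\mathbb R^{\tilde d}\times\mathbb R^d$ to $\mathbb R^d$ with $P_{(X_0,\dots,X_T)|Y=y}=P_{X_0|Y=y}\times\mathcal K_1(y,\cdot,\cdot)\times\cdots\times\mathcal K_T(y,\cdot,\cdot)$ for $P_Y$-a.e. $y$. Random variables $(Y_T,\dots,Y_0)$ with values in $\mathbb R^d$ form a *reverse* of it if for $P_Y$-a.e. $y$ every $P_{Y_t|Y=y}$ has a strictly positive density, and there are Markov kernels $\mathcal R_t$ with $P_{(Y_T,\dots,Y_0)|Y=y}=P_{X|Y=y}\times\mathcal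 R_T(y,\cdot,\cdot)\times\cdots\times\mathcal R_1(y,\cdot,\cdot)$ for $P_Y$-a.e. $y$, such that for each $t$ and $P_{(Y,X_t)}$-a.e. $(y,x)$ the measures $\mathcal R_t(y,x,\cdot)$ and $P_{X_{t-1}|X_t=x,Y=y}$ are mutually absolutely continuous. Write $P_{(X_0^y,\dots,X_T^y)}=P_{(X_0,\dots,X_T)|Y=y}$ and $P_{(Y_0^y,\dots,Y_T^y)}=P_{(Y_0,\dots,Y_T)|Y=y}$, and let $f_t(\cdot,x_t)=f_t^y(\cdot,x_t)$ be the Radon–Nikodym derivative of $P_{Y_{t-1}|Y_t=x_t,Y=y}$ with respect to $P_{X_{t-1}|X_t=x_t,Y=y}$ (in a jointly measurable version). Let $(X_0,\dots,X_T)$ be a conditional stochastic normalizing flow conditioned to $Y$ with reverse $(Y_T,\dots,Y_0)$, and suppose $P_{X_0|Y=y}=P_Z$ for $P_Y$-a.e. $y$. Expectations below are taken in $[-\infty,\infty]$. (i) Let $X$ and $Y$ have densities $p_X,p_Y$, let $P_{Y|X=x}$ have the density $p_{Y|X=x}$ for $P_X$-a.e. $x$ (jointly measurable in $(x,y)$),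 and let $\mathbb E[\log p_Z(Z)]$ and $\mathbb E[\log p_Y(Y)]$ be finite, that is, $\log p_Z(Z)$ and $\log p_Y(Y)$ are integrable. Then $$\mathrm{KL}(P_{(Y,X_0,\dots,X_T)},P_{(Y,Y_0,\dots,Y_T)})=\mathbb E_{y\sim P_Y}\Big[\mathbb E_{(x_0,\dots,x_T)\sim P_{(X_0^y,\dots,X_T^y)}}\Big[-\log p_{Y|X=x_T}(y)-\log p_X(x_T)-\sum_{t=1}^T\log\Big(\frac{f_t(x_{t-1},x_t)\,p_{X_{t-1}^y}(x_{t-1})}{p_{X_t^y}(x_t)}\Big)\Big]\Big]+\mathrm{const},$$ with $\mathrm{const}=\mathbb E[\log p_Z(Z)]+\mathbb E[\log p_Y(Y)]$, which does not depend on the flow or its reverse. (ii) Let $p_{X|Y=y}$ be the density of $P_{X|Y=y}$ (jointly measurable) and let $\log p_{X|Y=Y}(X)$ be integrable. Then $$\mathrm{KL}(P_{(Y,Y_0,\dots,Y_T)},P_{(Y,X_0,\dots,X_T)})=\mathbb E_{y\sim P_Y}\Big[\mathbb E_{(x_0,\dots,x_T)\sim P_{(Y_0^y,\dots,Y_T^y)}}\Big[-\log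 p_Z(x_0)+\sum_{t=1}^T\log\Big(\frac{f_t(x_{t-1},x_t)\,p_{X_{t-1}^y}(x_{t-1})}{p_{X_t^y}(x_t)}\Big)\Big]\Big]+\mathrm{const},$$ with $\mathrm{const}=\mathbb E_{(y,x)\sim P_{(Y,X)}}[\log p_{X|Y=y}(x)]$, which does not depend on the flow or its reverse. (iii) The likelihood is determined by the noise: if $X$ and $\eta$ are independent, $\eta$ has density $p_\eta$, and $P_{Y|X=x}$ has the density $p_{Y|X=x}$ for $P_X$-a.e. $x$, then $p_{Y|X=x}(y)=p_\eta(y-F(x))$ for $P_X$-a.e. $x$ and Lebesgue-a.e. $y$. -/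

import Mathlib

open MeasureTheory ProbabilityTheory
open scoped ENNReal

noncomputable section

/-- `p` is a (real-valued, nonnegative) Lebesgue density of the measure `μ` on `ℝⁿ`. -/
def HasDensity {n : ℕ} (μ : Measure (EuclideanSpace ℝ (Fin n)))
    (p : EuclideanSpace ℝ (Fin n) → ℝ) : Prop :=
  Measurable p ∧ (∀ x, 0 ≤ p x) ∧ μ = volume.withDensity (fun x => ENNReal.ofReal (p x))

/-- `p v` is a Lebesgue density of the regular conditional distribution `P_{U | V = v}`,
for `P_V`-almost every `v`. -/
def HasCondDensity {Ω : Type*} [MeasurableSpace Ω] {n k : ℕ} (P : Measure Ω) [IsFiniteMeasure P]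
    (U : Ω → EuclideanSpace ℝ (Fin n)) (V : Ω → EuclideanSpace ℝ (Fin k))
    (p : EuclideanSpace ℝ (Fin k) → EuclideanSpace ℝ (Fin n) → ℝ) : Prop :=
  Measurable (Function.uncurry p) ∧ ∀ᵐ v ∂(P.map V), HasDensity (condDistrib U V P v) (p v)

/-- `P_{U | V = v}` has a strictly positive Lebesgue density for `P_V`-almost every `v`. -/
def HasPosCondDensity {Ω : Type*} [MeasurableSpace Ω] {n k : ℕ} (P : Measure Ω)
    [IsFiniteMeasure P]
    (U : Ω → EuclideanSpace ℝ (Fin n)) (V : Ω → EuclideanSpace ℝ (Fin k)) : Prop :=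
  ∃ p : EuclideanSpace ℝ (Fin k) → EuclideanSpace ℝ (Fin n) → ℝ,
    HasCondDensity P U V p ∧ ∀ᵐ v ∂(P.map V), ∀ u, 0 < p v u

/-- The path measure `μ × K₁ × ⋯ × K_T` on `E^{T+1}`; the kernel `K i` leads from coordinate
`i` to coordinate `i + 1`. -/
def chainMeasure {E : Type*} [MeasurableSpace E] (μ : Measure E) :
    (T : ℕ) → (Fin T → Kernel E E) → Measure (Fin (T + 1) → E)
  | 0, _ => μ.map (fun x _ => x)
  | T + 1, K =>
      ((chainMeasure μ T (fun i => K i.castSucc)) ⊗ₘ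
        ((K (Fin.last T)).comap (fun x : Fin (T + 1) → E => x (Fin.last T))
          (measurable_pi_apply _))).map
        (fun z => Fin.snoc (α := fun _ => E) z.1 z.2)

/-- `(X₀, …, X_T)` is the path of a conditional stochastic normalizing flow conditioned to `Y`. -/
structure IsCondSNF {Ω : Type*} [MeasurableSpace Ω] {d m T : ℕ} (P : Measure Ω)
    [IsFiniteMeasure P] (Y : Ω → EuclideanSpace ℝ (Fin m))
    (X : Fin (T + 1) → Ω → EuclideanSpace ℝ (Fin d)) : Prop where
  measurable : ∀ t, Measurable (X t)
  density : ∀ t, HasPosCondDensity P (X t) Y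
  kernels : ∃ K : Fin T → Kernel (EuclideanSpace ℝ (Fin m) × EuclideanSpace ℝ (Fin d))
      (EuclideanSpace ℝ (Fin d)),
    (∀ t, IsMarkovKernel (K t)) ∧
    ∀ᵐ y ∂(P.map Y), condDistrib (fun ω t => X t ω) Y P y =
      chainMeasure (condDistrib (X 0) Y P y) T
        (fun t => (K t).comap (fun x => (y, x)) measurable_prodMk_left)

/-- `(Y_T, …, Y_0)` (written `Yr`) is a reverse of the conditional path `(X₀, …, X_T)`
(written `Xp`), started in the posterior `P_{X | Y = y}`. The kernel `R t` leads from
`Yr t.succ` to `Yr t.castSucc`. -/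
structure IsCondReverse {Ω : Type*} [MeasurableSpace Ω] {d m T : ℕ} (P : Measure Ω)
    [IsFiniteMeasure P] (X : Ω → EuclideanSpace ℝ (Fin d)) (Y : Ω → EuclideanSpace ℝ (Fin m))
    (Xp Yr : Fin (T + 1) → Ω → EuclideanSpace ℝ (Fin d)) : Prop where
  measurable : ∀ t, Measurable (Yr t)
  density : ∀ t, HasPosCondDensity P (Yr t) Y
  kernels : ∃ R : Fin T → Kernel (EuclideanSpace ℝ (Fin m) × EuclideanSpace ℝ (Fin d))
      (EuclideanSpace ℝ (Fin d)),
    (∀ t, IsMarkovKernel (R t)) ∧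
    (∀ᵐ y ∂(P.map Y), condDistrib (fun ω t => Yr (Fin.rev t) ω) Y P y =
      chainMeasure (condDistrib X Y P y) T
        (fun t => (R (Fin.rev t)).comap (fun x => (y, x)) measurable_prodMk_left)) ∧
    ∀ t : Fin T, ∀ᵐ z ∂(P.map (fun ω => (Y ω, Xp t.succ ω))),
      R t z ≪ condDistrib (Xp t.castSucc) (fun ω => (Y ω, Xp t.succ ω)) P z ∧
      condDistrib (Xp t.castSucc) (fun ω => (Y ω, Xp t.succ ω)) P z ≪ R t z

/-- `f t y · x` is the Radon-Nikodym derivative of `P_{Y_{t-1} | Y_t = x, Y = y}` with respect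
to `P_{X_{t-1} | X_t = x, Y = y}`, for almost every `(y, x)`, in a version that is jointly
measurable. -/
def IsBackwardRatio {Ω : Type*} [MeasurableSpace Ω] {d m T : ℕ} (P : Measure Ω)
    [IsFiniteMeasure P] (Y : Ω → EuclideanSpace ℝ (Fin m))
    (Xp Yr : Fin (T + 1) → Ω → EuclideanSpace ℝ (Fin d))
    (f : Fin T → EuclideanSpace ℝ (Fin m) → EuclideanSpace ℝ (Fin d) →
      EuclideanSpace ℝ (Fin d) → ℝ) : Prop :=
  ∀ t : Fin T,
    Measurable (fun z : EuclideanSpace ℝ (Fin m) × EuclideanSpace ℝ (Fin d) ×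
      EuclideanSpace ℝ (Fin d) => f t z.1 z.2.1 z.2.2) ∧
    ∀ᵐ z ∂(P.map (fun ω => (Y ω, Xp t.succ ω))),
      (fun x => f t z.1 x z.2)
        =ᵐ[condDistrib (Xp t.castSucc) (fun ω => (Y ω, Xp t.succ ω)) P z]
      (fun x => ((condDistrib (Yr t.castSucc) (fun ω => (Y ω, Yr t.succ ω)) P z).rnDeriv
        (condDistrib (Xp t.castSucc) (fun ω => (Y ω, Xp t.succ ω)) P z) x).toReal)

/-- Expectation with values in `[-∞, ∞]`: the integral of the positive part minus the integral
of the negative part. If both are infinite, the value is `-∞`. -/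
def eexpect {α : Type*} [MeasurableSpace α] (μ : Measure α) (g : α → EReal) : EReal :=
  ((∫⁻ x, (g x).toENNReal ∂μ : ℝ≥0∞) : EReal) - ((∫⁻ x, (-g x).toENNReal ∂μ : ℝ≥0∞) : EReal)

end

/-!
Given `Y = y`, the forward path is a Markov chain, and so is its time reversal: started in the law
of the end point, it runs through the backward conditional laws of `X_{t-1}` given `X_t` and
`Y = y` (`map_rev_chainMeasure`, by detailed balance along each edge). The path `(Y_T, …, Y_0)` is
a chain in the same direction, started in the posterior, whose steps have the densities `f t` with
respect to these backward laws. Hence the reverse path has the density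
`q_y(x_T) / p_T^y(x_T) * ∏ f_t(x_{t-1}, x_t)` with respect to the forward path, where `q_y` is the
posterior density (`map_rev_chainMeasure_eq_withDensity`, `map_reverse_eq_withDensity`). It is
positive almost everywhere, so the two laws are equivalent.

Taking logarithms and inserting `p_{t-1}^y / p_t^y`, which telescopes to `p_0^y / p_T^y` with
`p_0^y = p_Z`, gives the log-likelihood ratio (`llr_reverse_ae_eq`). In the forward divergence the
posterior density is rewritten by Bayes' formula (`bayes_ae`), in the reverse one it is integrated.

The Kullback-Leibler divergence is the extended expectation of the log-likelihood ratio, whose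
negative part is always integrable, since `-r log r ≤ 1`. This bound is what allows the integrable
constants to be split off and the expectation to be iterated, even when the divergence is infinite
(`coe_klDiv_eq_iterated`). The likelihood formula is the translation invariance of Lebesgue
measure.
-/

/-! ### Path measures of Markov chains -/

section Chain

variable {E : Type*} [MeasurableSpace E]

lemma measurable_finConst (T : ℕ) : Measurable (fun (x : E) (_ : Fin T) => x) :=
  measurable_pi_iff.2 fun _ => measurable_id

lemma measurable_finInit (T : ℕ) :
    Measurable (fun (x : Fin (T + 1) → E) (i : Fin T) => x i.castSucc) :=
  measurable_pi_iff.2 fun _ => measurable_pi_apply _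

lemma measurable_finSnoc (T : ℕ) :
    Measurable (fun z : (Fin T → E) × E => (Fin.snoc z.1 z.2 : Fin (T + 1) → E)) := by
  refine measurable_pi_iff.2 fun i => ?_
  induction i using Fin.lastCases with
  | last => simpa using measurable_snd
  | cast i => simpa using! (measurable_pi_apply i).comp measurable_fst

lemma measurable_finCons (T : ℕ) :
    Measurable (fun z : (Fin T → E) × E => (Fin.cons z.2 z.1 : Fin (T + 1) → E)) := by
  refine measurable_pi_iff.2 fun i => ?_
  induction i using Fin.cases with
  | zero => simpa using measurable_snd
  | succ i => simpa using! (measurable_pi_apply i).comp measurable_fst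

lemma measurable_finRev (T : ℕ) : Measurable (fun (x : Fin T → E) (i : Fin T) => x i.rev) :=
  measurable_pi_iff.2 fun i => measurable_pi_apply i.rev

instance sFinite_chainMeasure (μ : Measure E) [SFinite μ] (T : ℕ) (K : Fin T → Kernel E E) :
    SFinite (chainMeasure μ T K) := by
  cases T with
  | zero => unfold chainMeasure; infer_instance
  | succ T => unfold chainMeasure; infer_instance

lemma lintegral_chainMeasure_zero (μ : Measure E) (K : Fin 0 → Kernel E E)
    {g : (Fin 1 → E) → ℝ≥0∞} (hg : Measurable g) :
    ∫⁻ x, g x ∂chainMeasure μ 0 K = ∫⁻ x, g (fun _ => x) ∂μ := by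
  rw [chainMeasure, lintegral_map hg (measurable_finConst _)]

lemma lintegral_chainMeasure_succ (μ : Measure E) [SFinite μ] (T : ℕ)
    (K : Fin (T + 1) → Kernel E E) [∀ t, IsSFiniteKernel (K t)]
    {g : (Fin (T + 2) → E) → ℝ≥0∞} (hg : Measurable g) :
    ∫⁻ x, g x ∂chainMeasure μ (T + 1) K =
      ∫⁻ x, ∫⁻ b, g (Fin.snoc (α := fun _ => E) x b) ∂K (Fin.last T) (x (Fin.last T))
        ∂chainMeasure μ T (fun i => K i.castSucc) := by
  rw [chainMeasure, lintegral_map hg (measurable_finSnoc _)]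
  exact Measure.lintegral_compProd (hg.comp (measurable_finSnoc _))

/-- If `K` is the time reversal of `B'`, the chain started from `m'` with first step `B'` is
obtained by running the chain from `m` and then prepending a step of `K`. -/
lemma lintegral_chainMeasure_cons {m m' : Measure E} [SFinite m] [SFinite m'] {K B' : Kernel E E}
    [IsSFiniteKernel K] [IsSFiniteKernel B'] (h : (m ⊗ₘ K).map Prod.swap = m' ⊗ₘ B')
    (T : ℕ) (B : Fin T → Kernel E E) [∀ t, IsSFiniteKernel (B t)]
    {g : (Fin (T + 2) → E) → ℝ≥0∞} (hg : Measurable g) :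
    ∫⁻ x, g x ∂chainMeasure m' (T + 1) (Fin.cons (α := fun _ => Kernel E E) B' B) =
      ∫⁻ x, ∫⁻ a, g (Fin.cons (α := fun _ => E) a x) ∂K (x 0) ∂chainMeasure m T B := by
  have hcons : ∀ (T : ℕ) (B : Fin T → Kernel E E) [∀ t, IsSFiniteKernel (B t)],
      ∀ t, IsSFiniteKernel (Fin.cons (α := fun _ => Kernel E E) B' B t) := by
    intro T B _ t
    induction t using Fin.cases with
    | zero => simpa
    | succ t => simpa using inferInstanceAs (IsSFiniteKernel (B t))
  induction T with
  | zero =>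
    have := hcons 0 B
    have hg' : Measurable fun z : E × E => g (Fin.snoc (α := fun _ => E) (fun _ => z.1) z.2) :=
      hg.comp ((measurable_finSnoc 1).comp
        ((measurable_pi_iff.2 fun _ => measurable_fst).prodMk measurable_snd))
    have hl := lintegral_map hg' (measurable_swap (α := E) (β := E)) (μ := m ⊗ₘ K)
    rw [h, Measure.lintegral_compProd hg',
      Measure.lintegral_compProd (f := fun z => g (Fin.snoc (α := fun _ => E) (fun _ => z.swap.1)
        z.swap.2)) (hg'.comp measurable_swap)] at hl
    rw [lintegral_chainMeasure_succ _ _ _ hg, lintegral_chainMeasure_zero,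
      lintegral_chainMeasure_zero]
    · refine hl.trans ?_
      refine lintegral_congr fun x => lintegral_congr fun a => ?_
      simp only [Prod.swap]
      congr 1
      ext i
      fin_cases i <;> rfl
    · exact Measurable.lintegral_kernel_prod_right' (κ := K.comap (fun x : Fin 1 → E => x 0)
        (measurable_pi_apply _)) (hg.comp (measurable_finCons 1))
    · exact Measurable.lintegral_kernel_prod_right' (κ := (Fin.cons (α := fun _ => Kernel E E) B' B
        (Fin.last 0)).comap (fun x : Fin 1 → E => x (Fin.last 0))
        (measurable_pi_apply _)) (hg.comp (measurable_finSnoc 1))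
  | succ T ih =>
    have := hcons (T + 1) B
    have hc : (fun i : Fin (T + 1) => Fin.cons (α := fun _ => Kernel E E) B' B i.castSucc) =
        Fin.cons (α := fun _ => Kernel E E) B' (fun i => B i.castSucc) := by
      ext1 i
      induction i using Fin.cases with
      | zero => rfl
      | succ i => rfl
    have hmeas : Measurable fun x : Fin (T + 2) → E =>
        ∫⁻ b, g (Fin.snoc (α := fun _ => E) x b) ∂B (Fin.last T) (x (Fin.last (T + 1))) :=
      Measurable.lintegral_kernel_prod_right' (κ := (B (Fin.last T)).comap
        (fun x : Fin (T + 2) → E => x (Fin.last (T + 1)))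
        (measurable_pi_apply _)) (hg.comp (measurable_finSnoc (T + 2)))
    have hlast : Fin.cons (α := fun _ => Kernel E E) B' B (Fin.last (T + 1)) = B (Fin.last T) := by
      rw [← Fin.succ_last, Fin.cons_succ]
    -- given the path, the appended and the prepended step are independent, hence commute
    rw [lintegral_chainMeasure_succ _ _ _ hg, hc, hlast, ih _ hmeas,
      lintegral_chainMeasure_succ]
    · refine lintegral_congr fun x => ?_
      simp only [← Fin.succ_last, Fin.cons_succ, Fin.cons_snoc_eq_snoc_cons, ← Fin.castSucc_zero,
        Fin.snoc_castSucc]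
      rw [lintegral_lintegral_swap]
      refine (hg.comp ((measurable_finSnoc (T + 2)).comp
        (((measurable_finCons (T + 1)).comp (measurable_const.prodMk measurable_fst)).prodMk
          measurable_snd))).aemeasurable
    · exact Measurable.lintegral_kernel_prod_right' (κ := K.comap (fun x : Fin (T + 2) → E => x 0)
        (measurable_pi_apply _)) (hg.comp (measurable_finCons (T + 2)))

/-- Time reversal of a Markov chain: if `B t` disintegrates the law of the `t`-th edge from its
end point, the reversed path is the chain with the kernels `B t` in reversed order. -/
lemma map_rev_chainMeasure (T : ℕ) (m : Fin (T + 1) → Measure E) [∀ t, SFinite (m t)]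
    (K B : Fin T → Kernel E E) [∀ t, IsSFiniteKernel (K t)] [∀ t, IsSFiniteKernel (B t)]
    (h : ∀ t, (m t.castSucc ⊗ₘ K t).map Prod.swap = m t.succ ⊗ₘ B t) :
    (chainMeasure (m 0) T K).map (fun x i => x i.rev) =
      chainMeasure (m (Fin.last T)) T (fun i => B i.rev) := by
  refine Measure.ext_of_lintegral _ fun g hg => ?_
  rw [lintegral_map hg (measurable_finRev _)]
  induction T with
  | zero =>
    rw [lintegral_chainMeasure_zero _ _ hg]
    exact lintegral_chainMeasure_zero _ _ (hg.comp (measurable_finRev _))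
  | succ T ih =>
    have hB : (fun i : Fin (T + 1) => B i.rev) = Fin.cons (α := fun _ => Kernel E E)
        (B (Fin.last T)) (fun i => B i.rev.castSucc) := by
      ext1 i
      induction i using Fin.cases with
      | zero => simp
      | succ i => simp [Fin.rev_succ]
    have hmeas : Measurable fun x : Fin (T + 1) → E =>
        ∫⁻ b, g (Fin.cons (α := fun _ => E) b x) ∂K (Fin.last T) (x 0) :=
      Measurable.lintegral_kernel_prod_right' (κ := (K (Fin.last T)).comap
        (fun x : Fin (T + 1) → E => x 0)
        (measurable_pi_apply _)) (hg.comp (measurable_finCons (T + 1)))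
    have hi := ih (fun t => m t.castSucc) (fun t => K t.castSucc) (fun t => B t.castSucc)
      (fun t => by simpa using h t.castSucc) _ hmeas
    rw [hB, ← Fin.succ_last, lintegral_chainMeasure_cons (h (Fin.last T)) _ _ hg]
    refine (lintegral_chainMeasure_succ _ _ _ (hg.comp (measurable_finRev _))).trans ?_
    refine Eq.trans ?_ hi
    refine lintegral_congr fun x => ?_
    have hr : ∀ b, (fun i : Fin (T + 2) => (Fin.snoc x b : Fin (T + 2) → E) i.rev) =
        (Fin.cons b (fun i => x i.rev) : Fin (T + 2) → E) := by
      intro b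
      ext i
      induction i using Fin.cases with
      | zero => simp
      | succ i => simp [Fin.rev_succ]
    simp [hr]

lemma map_init_chainMeasure (μ : Measure E) [SFinite μ] (T : ℕ)
    (K : Fin (T + 1) → Kernel E E) [∀ t, IsMarkovKernel (K t)] :
    (chainMeasure μ (T + 1) K).map (fun x i => x (Fin.castSucc i)) =
      chainMeasure μ T (fun i => K i.castSucc) := by
  have hm := measurable_finInit (E := E) (T + 1)
  refine Measure.ext_of_lintegral _ fun g hg => ?_
  rw [lintegral_map hg hm]
  refine (lintegral_chainMeasure_succ _ _ _ (hg.comp hm)).trans ?_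
  simp

lemma map_zero_chainMeasure (μ : Measure E) [SFinite μ] (T : ℕ)
    (K : Fin T → Kernel E E) [∀ t, IsMarkovKernel (K t)] :
    (chainMeasure μ T K).map (fun x => x 0) = μ := by
  induction T with
  | zero =>
    rw [chainMeasure]
    exact (Measure.map_map (measurable_pi_apply _) (measurable_finConst _)).trans Measure.map_id
  | succ T ih =>
    have h := ih (fun i => K i.castSucc)
    rw [← map_init_chainMeasure μ T K] at h
    exact (Measure.map_map (measurable_pi_apply _) (measurable_finInit _)).symm.trans h

/-- The law of an edge of the chain. -/
lemma map_edge_chainMeasure (μ : Measure E) [SFinite μ] (T : ℕ)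
    (K : Fin T → Kernel E E) [∀ t, IsMarkovKernel (K t)] (t : Fin T) :
    (chainMeasure μ T K).map (fun x => (x t.castSucc, x t.succ)) =
      (chainMeasure μ T K).map (fun x => x t.castSucc) ⊗ₘ K t := by
  induction T with
  | zero => exact t.elim0
  | succ T ih =>
    have hm := measurable_finInit (E := E) (T + 1)
    induction t using Fin.lastCases with
    | last =>
      refine Measure.ext_of_lintegral _ fun g hg => ?_
      have hs : SFinite ((chainMeasure μ (T + 1) K).map (fun x => x (Fin.last T).castSucc)) :=
        inferInstance
      rw [lintegral_map hg ((measurable_pi_apply _).prodMk (measurable_pi_apply _)),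
        Measure.lintegral_compProd hg, lintegral_map hg.lintegral_kernel_prod_right'
          (measurable_pi_apply _), lintegral_chainMeasure_succ, lintegral_chainMeasure_succ]
      · simp
      · exact hg.lintegral_kernel_prod_right'.comp (measurable_pi_apply _)
      · exact hg.comp ((measurable_pi_apply _).prodMk (measurable_pi_apply _))
    | cast t =>
      have hi := ih (fun i => K i.castSucc) t
      rw [← map_init_chainMeasure μ T K, Measure.map_map
        ((measurable_pi_apply _).prodMk (measurable_pi_apply _)) hm,
        Measure.map_map (measurable_pi_apply _) hm] at hi
      exact hi

/-- Changing the initial law and every step by a density changes the law of the path by the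
product of these densities. -/
lemma chainMeasure_withDensity (T : ℕ) (μ ν : Measure E) [SFinite μ] [SFinite ν]
    (B R : Fin T → Kernel E E) [∀ t, IsMarkovKernel (B t)] [∀ t, IsSFiniteKernel (R t)]
    {g : E → ℝ≥0∞} (hg : Measurable g) (hν : ν = μ.withDensity g)
    {h : Fin T → E → E → ℝ≥0∞} (hh : ∀ t, Measurable (Function.uncurry (h t)))
    (hR : ∀ t, ∀ᵐ x ∂((chainMeasure μ T B).map (fun x => x t.castSucc)),
      R t x = (B t x).withDensity (h t x)) :
    chainMeasure ν T R = (chainMeasure μ T B).withDensity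
      (fun x => g (x 0) * ∏ t, h t (x t.castSucc) (x t.succ)) := by
  have hD : ∀ (T : ℕ) (h : Fin T → E → E → ℝ≥0∞), (∀ t, Measurable (Function.uncurry (h t))) →
      Measurable (fun x : Fin (T + 1) → E => g (x 0) * ∏ t, h t (x t.castSucc) (x t.succ)) := by
    intro T h hh
    refine (hg.comp (measurable_pi_apply _)).mul (Finset.measurable_prod _ fun t _ => ?_)
    have hp : Measurable fun x : Fin (T + 1) → E => (x t.castSucc, x t.succ) :=
      (measurable_pi_apply _).prodMk (measurable_pi_apply _)
    exact (hh t).comp hp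
  induction T with
  | zero =>
    refine Measure.ext_of_lintegral _ fun G hG => ?_
    rw [lintegral_withDensity_eq_lintegral_mul _ (hD 0 h hh) hG,
      lintegral_chainMeasure_zero _ _ hG, lintegral_chainMeasure_zero _ _ ((hD 0 h hh).mul hG), hν,
      lintegral_withDensity_eq_lintegral_mul _ hg (g := fun x => G fun _ => x)
        (hG.comp (measurable_finConst _))]
    simp
  | succ T ih =>
    have hm := measurable_finInit (E := E) (T + 1)
    have hi := ih (fun t => B t.castSucc) (fun t => R t.castSucc) (h := fun t => h t.castSucc)
      (fun t => hh t.castSucc) (fun t => by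
        have := hR t.castSucc
        rw [← map_init_chainMeasure μ T B, Measure.map_map (measurable_pi_apply _) hm]
        exact this)
    have hl : ∀ᵐ x ∂(chainMeasure μ T (fun t => B t.castSucc)),
        R (Fin.last T) (x (Fin.last T)) =
          (B (Fin.last T) (x (Fin.last T))).withDensity (h (Fin.last T) (x (Fin.last T))) := by
      have := hR (Fin.last T)
      rw [show (fun x : Fin (T + 2) → E => x (Fin.last T).castSucc) =
          (fun x : Fin (T + 1) → E => x (Fin.last T)) ∘ (fun x i => x (Fin.castSucc i)) from rfl,
        ← Measure.map_map (measurable_pi_apply _) hm, map_init_chainMeasure] at this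
      exact ae_of_ae_map (measurable_pi_apply _).aemeasurable this
    refine Measure.ext_of_lintegral _ fun G hG => ?_
    have hmeas : Measurable fun x : Fin (T + 1) → E =>
        ∫⁻ b, G (Fin.snoc (α := fun _ => E) x b) ∂(R (Fin.last T) (x (Fin.last T))) :=
      Measurable.lintegral_kernel_prod_right' (κ := (R (Fin.last T)).comap
        (fun x : Fin (T + 1) → E => x (Fin.last T))
        (measurable_pi_apply _)) (hG.comp (measurable_finSnoc (T + 1)))
    rw [lintegral_withDensity_eq_lintegral_mul _ (hD _ h hh) hG,
      lintegral_chainMeasure_succ _ _ _ hG, hi,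
      lintegral_withDensity_eq_lintegral_mul _ (hD _ _ fun t => hh t.castSucc) hmeas,
      lintegral_chainMeasure_succ _ _ _ ((hD _ h hh).mul hG)]
    refine lintegral_congr_ae ?_
    filter_upwards [hl] with x hx
    have hhx : Measurable (h (Fin.last T) (x (Fin.last T))) :=
      (hh (Fin.last T)).comp measurable_prodMk_left
    have hGx : Measurable fun b => G (Fin.snoc (α := fun _ => E) x b) :=
      hG.comp ((measurable_finSnoc (T + 1)).comp measurable_prodMk_left)
    rw [Pi.mul_apply, hx, lintegral_withDensity_eq_lintegral_mul _ hhx hGx,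
      ← lintegral_const_mul _ (hhx.mul hGx)]
    refine lintegral_congr fun b => ?_
    simp only [Pi.mul_apply, Fin.prod_univ_castSucc, Fin.succ_last, Fin.snoc_last,
      Fin.snoc_castSucc, Fin.succ_castSucc]
    rw [show (0 : Fin (T + 2)) = Fin.castSucc 0 from rfl, Fin.snoc_castSucc]
    ring

end Chain

/-! ### Expectations in `EReal` and the Kullback-Leibler divergence -/

section Expect

variable {α β : Type*} [MeasurableSpace α] [MeasurableSpace β]

lemma eexpect_congr_ae {μ : Measure α} {g g' : α → EReal} (h : g =ᵐ[μ] g') :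
    eexpect μ g = eexpect μ g' := by
  unfold eexpect
  congr 2
  · exact lintegral_congr_ae (by filter_upwards [h] with x hx; rw [hx])
  · exact lintegral_congr_ae (by filter_upwards [h] with x hx; rw [hx])

lemma eexpect_real (μ : Measure α) (g : α → ℝ) :
    eexpect μ (fun x => (g x : EReal)) =
      ((∫⁻ x, ENNReal.ofReal (g x) ∂μ : ℝ≥0∞) : EReal)
        - ((∫⁻ x, ENNReal.ofReal (-g x) ∂μ : ℝ≥0∞) : EReal) := by
  unfold eexpect
  simp only [← EReal.coe_neg, EReal.real_coe_toENNReal]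

/-- Subtraction in `EReal` is determined by cross addition in `ℝ≥0∞`. -/
lemma coe_sub_coe_eq {a b c d : ℝ≥0∞} (hb : b ≠ ∞) (hd : d ≠ ∞) (h : a + d = c + b) :
    (a : EReal) - (b : EReal) = (c : EReal) - (d : EReal) := by
  lift b to NNReal using hb
  lift d to NNReal using hd
  induction a with
  | top =>
    have : c = ⊤ := by simpa using h.symm
    subst this
    change (⊤ : EReal) - ((b : ℝ) : EReal) = ⊤ - ((d : ℝ) : EReal)
    simp
  | coe a =>
    induction c with
    | top => simp at h
    | coe c =>
      norm_cast at h
      have h' : (a : ℝ) + d = c + b := by exact_mod_cast h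
      change (((a : ℝ) : EReal)) - ((b : ℝ) : EReal) = ((c : ℝ) : EReal) - ((d : ℝ) : EReal)
      norm_cast
      linarith

/-- An integrable summand can be taken out of the extended expectation as soon as the negative
part is integrable. -/
lemma eexpect_add_integrable {μ : Measure α} {g h : α → ℝ} (hg : AEMeasurable g μ)
    (hgneg : ∫⁻ x, ENNReal.ofReal (-g x) ∂μ ≠ ∞) (hh : Integrable h μ) :
    eexpect μ (fun x => ((g x + h x : ℝ) : EReal)) =
      eexpect μ (fun x => (g x : EReal)) + ((∫ x, h x ∂μ : ℝ) : EReal) := by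
  have hhm : AEMeasurable h μ := hh.aemeasurable
  have hp : ∫⁻ x, ENNReal.ofReal (h x) ∂μ ≠ ∞ := hh.lintegral_lt_top.ne
  have hn : ∫⁻ x, ENNReal.ofReal (-h x) ∂μ ≠ ∞ := hh.neg.lintegral_lt_top.ne
  have hgn : AEMeasurable (fun x => ENNReal.ofReal (-g x)) μ := hg.neg.ennreal_ofReal
  have hghm : AEMeasurable (fun x => ENNReal.ofReal (g x + h x)) μ := (hg.add hhm).ennreal_ofReal
  have hghn : AEMeasurable (fun x => ENNReal.ofReal (-(g x + h x))) μ :=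
    (hg.add hhm).neg.ennreal_ofReal
  have hgh : ∫⁻ x, ENNReal.ofReal (-(g x + h x)) ∂μ ≠ ∞ := by
    refine ne_top_of_le_ne_top (ENNReal.add_ne_top.2 ⟨hgneg, hn⟩) ?_
    rw [← lintegral_add_left' hgn]
    refine lintegral_mono fun x => ?_
    rw [neg_add]
    exact ENNReal.ofReal_add_le
  have hI : ((∫ x, h x ∂μ : ℝ) : EReal) = ((∫⁻ x, ENNReal.ofReal (h x) ∂μ : ℝ≥0∞) : EReal)
      - ((∫⁻ x, ENNReal.ofReal (-h x) ∂μ : ℝ≥0∞) : EReal) := by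
    rw [integral_eq_lintegral_pos_part_sub_lintegral_neg_part hh, EReal.coe_sub,
      EReal.coe_ennreal_toReal hp, EReal.coe_ennreal_toReal hn]
  rw [eexpect_real, eexpect_real, hI]
  have key : (∫⁻ x, ENNReal.ofReal (g x + h x) ∂μ)
      + (∫⁻ x, ENNReal.ofReal (-g x) ∂μ + ∫⁻ x, ENNReal.ofReal (-h x) ∂μ)
      = (∫⁻ x, ENNReal.ofReal (g x) ∂μ + ∫⁻ x, ENNReal.ofReal (h x) ∂μ)
        + ∫⁻ x, ENNReal.ofReal (-(g x + h x)) ∂μ := by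
    rw [← lintegral_add_left' hgn, ← lintegral_add_left' hg.ennreal_ofReal,
      ← lintegral_add_left' hghm, ← lintegral_add_right' _ hghn]
    refine lintegral_congr fun x => ?_
    -- `r⁺ - r⁻ = r` for each of the three functions
    have hmax : ∀ r : ℝ, ENNReal.ofReal r = ENNReal.ofReal (max r 0) := fun r => by simp
    have hsub : ∀ r : ℝ, max r 0 - max (-r) 0 = r := max_zero_sub_eq_self
    rw [hmax (g x), hmax (h x), hmax (-g x), hmax (-h x), hmax (g x + h x), hmax (-(g x + h x))]
    rw [← ENNReal.ofReal_add, ← ENNReal.ofReal_add, ← ENNReal.ofReal_add, ← ENNReal.ofReal_add] <;>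
      try positivity
    congr 1
    linarith [hsub (g x), hsub (h x), hsub (g x + h x)]
  rw [coe_sub_coe_eq hgh (ENNReal.add_ne_top.2 ⟨hgneg, hn⟩) key, EReal.coe_ennreal_add,
    EReal.coe_ennreal_add]
  generalize (∫⁻ x, ENNReal.ofReal (g x) ∂μ) = a
  revert hgneg hp hn
  generalize (∫⁻ x, ENNReal.ofReal (-g x) ∂μ) = b
  generalize (∫⁻ x, ENNReal.ofReal (h x) ∂μ) = c
  generalize (∫⁻ x, ENNReal.ofReal (-h x) ∂μ) = d
  intro hb hc hd
  lift b to NNReal using hb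
  lift c to NNReal using hc
  lift d to NNReal using hd
  induction a with
  | top =>
    change ((⊤ : EReal) + ((c : ℝ) : EReal)) - (((b : ℝ) : EReal) + ((d : ℝ) : EReal)) =
      (⊤ - ((b : ℝ) : EReal)) + (((c : ℝ) : EReal) - ((d : ℝ) : EReal))
    norm_cast
  | coe a =>
    change (((a : ℝ) : EReal) + ((c : ℝ) : EReal)) - (((b : ℝ) : EReal) + ((d : ℝ) : EReal)) =
      (((a : ℝ) : EReal) - ((b : ℝ) : EReal)) + (((c : ℝ) : EReal) - ((d : ℝ) : EReal))
    simp only [← EReal.coe_add, ← EReal.coe_sub]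
    congr 1
    ring

/-- Fubini's theorem for extended expectations whose negative part is integrable. -/
lemma eexpect_compProd {μ : Measure α} [SFinite μ] {κ : Kernel α β} [IsSFiniteKernel κ]
    {g : α × β → ℝ} (hg : Measurable g)
    (hneg : ∫⁻ z, ENNReal.ofReal (-g z) ∂(μ ⊗ₘ κ) ≠ ∞) :
    eexpect μ (fun y => eexpect (κ y) (fun x => (g (y, x) : EReal))) =
      eexpect (μ ⊗ₘ κ) (fun z => (g z : EReal)) := by
  have hgn : Measurable fun z => ENNReal.ofReal (-g z) := hg.neg.ennreal_ofReal
  have hn := hneg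
  rw [Measure.lintegral_compProd hgn] at hn
  have hma : Measurable fun y => ∫⁻ x, ENNReal.ofReal (g (y, x)) ∂κ y :=
    hg.ennreal_ofReal.lintegral_kernel_prod_right'
  have hmb : Measurable fun y => ∫⁻ x, ENNReal.ofReal (-g (y, x)) ∂κ y :=
    hg.neg.ennreal_ofReal.lintegral_kernel_prod_right'
  simp only [eexpect_real]
  unfold eexpect
  rw [Measure.lintegral_compProd hg.ennreal_ofReal,
    Measure.lintegral_compProd hgn]
  have hfin := ae_lt_top hmb hn
  have hsplit : ∀ a b : ℝ≥0∞, b ≠ ∞ → ((a : EReal) - b).toENNReal = a - b ∧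
      (-((a : EReal) - b)).toENNReal = b - a := by
    intro a b hb
    refine ⟨by rw [EReal.toENNReal_sub (EReal.coe_ennreal_nonneg _)]; simp, ?_⟩
    rw [EReal.neg_sub (by simp) (by simp [hb]), add_comm, ← sub_eq_add_neg,
      EReal.toENNReal_sub (EReal.coe_ennreal_nonneg _)]
    simp
  have e1 : ∫⁻ y, (((∫⁻ x, ENNReal.ofReal (g (y, x)) ∂κ y : ℝ≥0∞) : EReal)
      - ((∫⁻ x, ENNReal.ofReal (-g (y, x)) ∂κ y : ℝ≥0∞) : EReal)).toENNReal ∂μ =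
      ∫⁻ y, (∫⁻ x, ENNReal.ofReal (g (y, x)) ∂κ y) - (∫⁻ x, ENNReal.ofReal (-g (y, x)) ∂κ y) ∂μ := by
    refine lintegral_congr_ae ?_
    filter_upwards [hfin] with y hy using (hsplit _ _ hy.ne).1
  have e2 : ∫⁻ y, (-(((∫⁻ x, ENNReal.ofReal (g (y, x)) ∂κ y : ℝ≥0∞) : EReal)
      - ((∫⁻ x, ENNReal.ofReal (-g (y, x)) ∂κ y : ℝ≥0∞) : EReal))).toENNReal ∂μ =
      ∫⁻ y, (∫⁻ x, ENNReal.ofReal (-g (y, x)) ∂κ y) - (∫⁻ x, ENNReal.ofReal (g (y, x)) ∂κ y) ∂μ := by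
    refine lintegral_congr_ae ?_
    filter_upwards [hfin] with y hy using (hsplit _ _ hy.ne).2
  rw [e1, e2]
  refine coe_sub_coe_eq ?_ hn ?_
  · exact ne_top_of_le_ne_top hn (lintegral_mono fun y => tsub_le_self)
  · rw [← lintegral_add_right _ hmb, ← lintegral_add_left hma]
    refine lintegral_congr fun y => ?_
    rw [tsub_add_eq_max, add_tsub_eq_max]

/-- The negative part of the log-likelihood ratio is always integrable. -/
lemma lintegral_neg_llr_ne_top {μ ν : Measure α} [IsFiniteMeasure μ] [IsFiniteMeasure ν]
    (h : μ ≪ ν) : ∫⁻ x, ENNReal.ofReal (-llr μ ν x) ∂μ ≠ ∞ := by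
  have hm : Measurable fun x => ENNReal.ofReal (-llr μ ν x) :=
    (measurable_llr μ ν).neg.ennreal_ofReal
  have e := lintegral_rnDeriv_mul h hm.aemeasurable
  rw [← e]
  refine ne_top_of_le_ne_top (measure_ne_top ν Set.univ) ?_
  rw [← lintegral_one]
  refine lintegral_mono_ae ?_
  filter_upwards [Measure.rnDeriv_lt_top μ ν] with x hx
  rw [llr, ← ENNReal.ofReal_toReal hx.ne, ENNReal.toReal_ofReal ENNReal.toReal_nonneg,
    ← ENNReal.ofReal_mul ENNReal.toReal_nonneg, ← ENNReal.ofReal_one]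
  refine ENNReal.ofReal_le_ofReal ?_
  -- `-r log r ≤ 1 - r ≤ 1`, by nonnegativity of `klFun`
  have := InformationTheory.klFun_nonneg (x := (μ.rnDeriv ν x).toReal) ENNReal.toReal_nonneg
  unfold InformationTheory.klFun at this
  nlinarith [ENNReal.toReal_nonneg (a := μ.rnDeriv ν x)]

/-- The Kullback-Leibler divergence is the extended expectation of the log-likelihood ratio. -/
lemma coe_klDiv_eq_eexpect {μ ν : Measure α} [IsProbabilityMeasure μ] [IsProbabilityMeasure ν]
    (h : μ ≪ ν) :
    (InformationTheory.klDiv μ ν : EReal) = eexpect μ (fun x => (llr μ ν x : EReal)) := by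
  have hn := lintegral_neg_llr_ne_top h
  rw [eexpect_real]
  by_cases hi : Integrable (llr μ ν) μ
  · have hp : ∫⁻ x, ENNReal.ofReal (llr μ ν x) ∂μ ≠ ∞ := hi.lintegral_lt_top.ne
    have h0 := InformationTheory.integral_llr_add_sub_measure_univ_nonneg h hi
    have ht := InformationTheory.toReal_klDiv h hi
    rw [← EReal.coe_ennreal_toReal (InformationTheory.klDiv_ne_top h hi), ht]
    simp only [probReal_univ, add_sub_cancel_right]
    rw [integral_eq_lintegral_pos_part_sub_lintegral_neg_part hi, EReal.coe_sub,
      EReal.coe_ennreal_toReal hp, EReal.coe_ennreal_toReal hn]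
  · have hp : ∫⁻ x, ENNReal.ofReal (llr μ ν x) ∂μ = ∞ := by
      by_contra hp
      refine hi ⟨(measurable_llr μ ν).aestronglyMeasurable, ?_⟩
      rw [HasFiniteIntegral]
      refine (lt_top_iff_ne_top.2 (ENNReal.add_ne_top.2 ⟨hp, hn⟩)).trans_le' ?_
      rw [← lintegral_add_left (measurable_llr μ ν).ennreal_ofReal]
      refine lintegral_mono fun x => ?_
      rw [← ofReal_norm, Real.norm_eq_abs]
      rcases abs_cases (llr μ ν x) with ⟨h', _⟩ | ⟨h', _⟩ <;> rw [h']
      · exact le_self_add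
      · exact le_add_self
    rw [InformationTheory.klDiv_of_not_integrable hi, hp]
    lift (∫⁻ x, ENNReal.ofReal (-llr μ ν x) ∂μ) to NNReal using hn with b
    rfl

/-- The divergence of a law on a product space as an iterated expectation, when the log-likelihood
ratio is `g` up to an integrable summand. -/
lemma coe_klDiv_eq_iterated {ρ : Measure α} [IsProbabilityMeasure ρ] {κ : Kernel α β}
    [IsMarkovKernel κ] {ν : Measure (α × β)} [IsProbabilityMeasure ν] (hac : ρ ⊗ₘ κ ≪ ν)
    {g h : α × β → ℝ} (hg : Measurable g) (hh : Integrable h (ρ ⊗ₘ κ))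
    (hgh : ∀ᵐ z ∂(ρ ⊗ₘ κ), llr (ρ ⊗ₘ κ) ν z = g z + h z) :
    (InformationTheory.klDiv (ρ ⊗ₘ κ) ν : EReal) =
      eexpect ρ (fun y => eexpect (κ y) (fun x => (g (y, x) : EReal)))
        + ((∫ z, h z ∂(ρ ⊗ₘ κ) : ℝ) : EReal) := by
  have hneg : ∫⁻ z, ENNReal.ofReal (-g z) ∂(ρ ⊗ₘ κ) ≠ ∞ := by
    have hp : ∫⁻ x, ENNReal.ofReal (h x) ∂(ρ ⊗ₘ κ) ≠ ∞ := hh.lintegral_lt_top.ne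
    refine ne_top_of_le_ne_top (ENNReal.add_ne_top.2 ⟨lintegral_neg_llr_ne_top hac, hp⟩) ?_
    have hm : Measurable fun z => ENNReal.ofReal (-llr (ρ ⊗ₘ κ) ν z) :=
      (measurable_llr _ ν).neg.ennreal_ofReal
    rw [← lintegral_add_left hm]
    refine lintegral_mono_ae ?_
    filter_upwards [hgh] with z hz
    refine le_trans (ENNReal.ofReal_le_ofReal (le_of_eq ?_)) ENNReal.ofReal_add_le
    rw [hz]; ring
  rw [coe_klDiv_eq_eexpect hac, eexpect_compProd hg hneg,
    ← eexpect_add_integrable hg.aemeasurable hneg hh]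
  exact eexpect_congr_ae (by filter_upwards [hgh] with z hz; rw [hz])

end Expect

/-! ### Density of a reversed chain -/

section ReverseChain

variable {E : Type*} [MeasurableSpace E]

/-- The law of a path whose reversal is a Markov chain with kernels `R t`, as a density with
respect to a Markov chain `μ` whose backward kernels are `B t`. -/
lemma map_rev_chainMeasure_eq_withDensity (T : ℕ) (m : Fin (T + 1) → Measure E)
    [∀ t, SFinite (m t)] (K B R : Fin T → Kernel E E) [∀ t, IsMarkovKernel (K t)]
    [∀ t, IsMarkovKernel (B t)] [∀ t, IsMarkovKernel (R t)] {μ : Measure (Fin (T + 1) → E)}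
    (hμ : μ = chainMeasure (m 0) T K) (hm : ∀ s, μ.map (fun x => x s) = m s)
    (hB : ∀ t, μ.map (fun x => (x t.succ, x t.castSucc)) = m t.succ ⊗ₘ B t)
    {n : Measure E} [SFinite n] {g : E → ℝ≥0∞} (hg : Measurable g)
    (hn : n = (m (Fin.last T)).withDensity g) {h : Fin T → E → E → ℝ≥0∞}
    (hh : ∀ t, Measurable (Function.uncurry (h t)))
    (hR : ∀ t, ∀ᵐ x ∂m t.succ, R t x = (B t x).withDensity (h t x)) :
    (chainMeasure n T (fun t => R t.rev)).map (fun x i => x i.rev) =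
      μ.withDensity (fun x => g (x (Fin.last T)) * ∏ t, h t (x t.succ) (x t.castSucc)) := by
  have hrev := measurable_finRev (E := E) (T + 1)
  have hedge : ∀ t, (m t.castSucc ⊗ₘ K t).map Prod.swap = m t.succ ⊗ₘ B t := by
    intro t
    have h1 := map_edge_chainMeasure (m 0) T K t
    rw [← hμ, hm] at h1
    have hp : Measurable fun x : Fin (T + 1) → E => (x t.castSucc, x t.succ) :=
      (measurable_pi_apply _).prodMk (measurable_pi_apply _)
    rw [← hB, ← h1, Measure.map_map measurable_swap hp]
    rfl
  have hback := map_rev_chainMeasure T m K B hedge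
  rw [← hμ] at hback
  have hd := chainMeasure_withDensity T (m (Fin.last T)) n (fun t => B t.rev) (fun t => R t.rev)
    hg hn (h := fun t => h t.rev) (fun t => hh t.rev) (by
      intro t
      rw [← hback, Measure.map_map (measurable_pi_apply _) hrev]
      have := hR t.rev
      rw [← hm] at this
      rw [← Fin.rev_castSucc] at this
      exact this)
  have hDm : Measurable (fun x : Fin (T + 1) → E =>
      g (x 0) * ∏ t : Fin T, h t.rev (x t.castSucc) (x t.succ)) := by
    refine (hg.comp (measurable_pi_apply _)).mul (Finset.measurable_prod _ fun t _ => ?_)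
    have hp : Measurable fun x : Fin (T + 1) → E => (x t.castSucc, x t.succ) :=
      (measurable_pi_apply _).prodMk (measurable_pi_apply _)
    exact (hh t.rev).comp hp
  have hDm' : Measurable (fun x : Fin (T + 1) → E =>
      g (x (Fin.last T)) * ∏ t, h t (x t.succ) (x t.castSucc)) := by
    refine (hg.comp (measurable_pi_apply _)).mul (Finset.measurable_prod _ fun t _ => ?_)
    have hp : Measurable fun x : Fin (T + 1) → E => (x t.succ, x t.castSucc) :=
      (measurable_pi_apply _).prodMk (measurable_pi_apply _)
    exact (hh t).comp hp
  rw [hd, ← hback]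
  refine Measure.ext_of_lintegral _ fun G hG => ?_
  have hGr : Measurable fun x : Fin (T + 1) → E => G fun i => x i.rev := hG.comp hrev
  rw [lintegral_map hG hrev, lintegral_withDensity_eq_lintegral_mul _ hDm hGr,
    lintegral_map (hDm.mul hGr) hrev, lintegral_withDensity_eq_lintegral_mul _ hDm' hG]
  refine lintegral_congr fun x => ?_
  have hprod : ∏ t : Fin T, h t.rev (x t.castSucc.rev) (x t.succ.rev) =
      ∏ t : Fin T, h t (x t.succ) (x t.castSucc) := by
    rw [← Equiv.prod_comp Fin.revPerm]
    refine Finset.prod_congr rfl fun t _ => ?_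
    simp [Fin.rev_castSucc, Fin.rev_succ]
  simp only [Pi.mul_apply, Fin.rev_zero, Fin.rev_rev, hprod]

end ReverseChain

/-! ### Conditional distributions given a common variable -/

section CondDistrib

variable {Ω α β γ : Type*} [MeasurableSpace Ω] {P : Measure Ω} [IsProbabilityMeasure P]
  [MeasurableSpace α] [StandardBorelSpace α] [Nonempty α]
  [MeasurableSpace β] [MeasurableSpace γ]
  {Y : Ω → γ} {U : Ω → α} {V : Ω → β}

lemma map_prodMk_prodMk_eq_compProd_iff (hY : Measurable Y) (hU : Measurable U) (hV : Measurable V)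
    (η : Kernel (γ × α) β) [IsMarkovKernel η] :
    P.map (fun ω => (Y ω, (U ω, V ω))) = P.map Y ⊗ₘ (condDistrib U Y P ⊗ₖ η) ↔
      P.map (fun ω => ((Y ω, U ω), V ω)) = P.map (fun ω => (Y ω, U ω)) ⊗ₘ η := by
  have h1 := Measure.compProd_assoc (μ := P.map Y) (κ := condDistrib U Y P) (η := η)
  rw [compProd_map_condDistrib hU.aemeasurable] at h1
  have h2 : P.map (fun ω => ((Y ω, U ω), V ω)) =
      (P.map (fun ω => (Y ω, (U ω, V ω)))).map MeasurableEquiv.prodAssoc.symm := by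
    rw [Measure.map_map (MeasurableEquiv.measurable _) (hY.prodMk (hU.prodMk hV))]
    rfl
  rw [← h1, h2]
  exact MeasurableEquiv.prodAssoc.symm.map_measurableEquiv_injective.eq_iff.symm

variable [StandardBorelSpace β] [Nonempty β]

/-- The conditional law of a pair given `Y = y` is disintegrated by the conditional law of the
second entry given `Y` and the first. -/
lemma condDistrib_prodMk (hY : Measurable Y) (hU : Measurable U) (hV : Measurable V) :
    ∀ᵐ y ∂P.map Y, condDistrib (fun ω => (U ω, V ω)) Y P y =
      condDistrib U Y P y ⊗ₘ (condDistrib V (fun ω => (Y ω, U ω)) P).sectR y := by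
  have h := condDistrib_ae_eq_of_measure_eq_compProd Y (hU.prodMk hV).aemeasurable
    ((map_prodMk_prodMk_eq_compProd_iff (P := P) hY hU hV
      (condDistrib V (fun ω => (Y ω, U ω)) P)).2
        (compProd_map_condDistrib hV.aemeasurable).symm)
  filter_upwards [h] with y hy
  rw [hy, Kernel.compProd_apply_eq_compProd_sectR]

/-- A kernel that disintegrates almost every conditional law of the pair `(U, V)` given `Y` is a
version of the conditional law of `V` given `(Y, U)`. -/
lemma condDistrib_eq_of_condDistrib_prodMk (hY : Measurable Y) (hU : Measurable U)
    (hV : Measurable V) (η : Kernel (γ × α) β) [IsMarkovKernel η]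
    (h : ∀ᵐ y ∂P.map Y, condDistrib (fun ω => (U ω, V ω)) Y P y =
      condDistrib U Y P y ⊗ₘ η.sectR y) :
    condDistrib V (fun ω => (Y ω, U ω)) P =ᵐ[P.map (fun ω => (Y ω, U ω))] η := by
  refine condDistrib_ae_eq_of_measure_eq_compProd _ hV.aemeasurable
    ((map_prodMk_prodMk_eq_compProd_iff hY hU hV η).1 ?_)
  rw [← compProd_map_condDistrib (hU.prodMk hV).aemeasurable]
  refine Measure.compProd_congr ?_
  filter_upwards [h] with y hy
  rw [hy, Kernel.compProd_apply_eq_compProd_sectR]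

lemma ae_of_ae_ae_condDistrib (hY : Measurable Y) (hU : Measurable U) {s : Set (γ × α)}
    (hs : MeasurableSet s) (h : ∀ᵐ y ∂P.map Y, ∀ᵐ u ∂condDistrib U Y P y, (y, u) ∈ s) :
    ∀ᵐ ω ∂P, (Y ω, U ω) ∈ s := by
  have h' := Measure.ae_compProd_of_ae_ae (p := fun z => z ∈ s) hs h
  rw [compProd_map_condDistrib hU.aemeasurable] at h'
  exact ae_of_ae_map (hY.prodMk hU).aemeasurable h'

lemma ae_ae_condDistrib (hU : Measurable U) {q : γ × α → Prop}
    (h : ∀ᵐ z ∂P.map (fun ω => (Y ω, U ω)), q z) :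
    ∀ᵐ y ∂P.map Y, ∀ᵐ u ∂condDistrib U Y P y, q (y, u) := by
  rw [← compProd_map_condDistrib hU.aemeasurable] at h
  exact Measure.ae_ae_of_ae_compProd h

/-- The edges of a path whose conditional law is a Markov chain. -/
lemma condDistrib_edge_of_eq_chainMeasure {T : ℕ} {W : Ω → Fin (T + 1) → α} (hW : Measurable W)
    {μ : γ → Measure α} [∀ y, SFinite (μ y)] {K : Fin T → Kernel (γ × α) α}
    [∀ t, IsMarkovKernel (K t)]
    (h : ∀ᵐ y ∂P.map Y, condDistrib W Y P y = chainMeasure (μ y) T (fun t => (K t).sectR y))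
    (t : Fin T) :
    ∀ᵐ y ∂P.map Y, condDistrib (fun ω => (W ω t.castSucc, W ω t.succ)) Y P y =
      condDistrib (fun ω => W ω t.castSucc) Y P y ⊗ₘ (K t).sectR y := by
  have hp : Measurable fun x : Fin (T + 1) → α => (x t.castSucc, x t.succ) :=
    (measurable_pi_apply _).prodMk (measurable_pi_apply _)
  have h1 := condDistrib_comp (μ := P) (mβ := inferInstance) Y hW.aemeasurable hp
  have h2 := condDistrib_comp (μ := P) (mβ := inferInstance) Y hW.aemeasurable
    (measurable_pi_apply (X := fun _ : Fin (T + 1) => α) t.castSucc)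
  filter_upwards [h, h1, h2] with y hy hy1 hy2
  rw [Kernel.map_apply _ hp, hy, map_edge_chainMeasure] at hy1
  rw [Kernel.map_apply _ (measurable_pi_apply _), hy] at hy2
  rw [← hy2] at hy1
  exact hy1

end CondDistrib

/-! ### Lebesgue densities of conditional laws, and Bayes' formula -/

section Density

variable {n k : ℕ}

lemma HasDensity.absolutelyContinuous {μ : Measure (EuclideanSpace ℝ (Fin n))}
    {p : EuclideanSpace ℝ (Fin n) → ℝ} (h : HasDensity μ p) : μ ≪ volume := by
  rw [h.2.2]
  exact withDensity_absolutelyContinuous _ _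

lemma HasDensity.ae_pos {μ : Measure (EuclideanSpace ℝ (Fin n))}
    {p : EuclideanSpace ℝ (Fin n) → ℝ} (h : HasDensity μ p) : ∀ᵐ x ∂μ, 0 < p x := by
  rw [h.2.2, ae_withDensity_iff h.1.ennreal_ofReal]
  refine Filter.Eventually.of_forall fun x hx => ?_
  by_contra hx'
  exact hx (ENNReal.ofReal_of_nonpos (not_lt.1 hx'))

lemma HasDensity.ae_eq {μ : Measure (EuclideanSpace ℝ (Fin n))}
    {p q : EuclideanSpace ℝ (Fin n) → ℝ} (hp : HasDensity μ p) (hq : HasDensity μ q) :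
    p =ᵐ[volume] q := by
  have h := hp.2.2.symm.trans hq.2.2
  rw [withDensity_eq_iff_of_sigmaFinite hp.1.ennreal_ofReal.aemeasurable
    hq.1.ennreal_ofReal.aemeasurable] at h
  filter_upwards [h] with x hx
  exact (ENNReal.ofReal_eq_ofReal_iff (hp.2.1 x) (hq.2.1 x)).1 hx

lemma HasDensity.volume_absolutelyContinuous {μ : Measure (EuclideanSpace ℝ (Fin n))}
    {p : EuclideanSpace ℝ (Fin n) → ℝ} (h : HasDensity μ p) (hpos : ∀ᵐ x, 0 < p x) :
    volume ≪ μ := by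
  rw [h.2.2]
  refine withDensity_absolutelyContinuous' h.1.ennreal_ofReal.aemeasurable ?_
  filter_upwards [hpos] with x hx
  simpa using hx

lemma HasDensity.eq_withDensity_div {μ ν : Measure (EuclideanSpace ℝ (Fin n))}
    {p q : EuclideanSpace ℝ (Fin n) → ℝ} (hp : HasDensity μ p) (hq : HasDensity ν q)
    (hpos : ∀ᵐ x, 0 < p x) : ν = μ.withDensity (fun x => ENNReal.ofReal (q x / p x)) := by
  have hdiv : Measurable fun x => ENNReal.ofReal (q x / p x) := (hq.1.div hp.1).ennreal_ofReal
  rw [hq.2.2, hp.2.2, ← withDensity_mul _ hp.1.ennreal_ofReal hdiv]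
  refine withDensity_congr_ae ?_
  filter_upwards [hpos] with x hx
  rw [Pi.mul_apply, ← ENNReal.ofReal_mul hx.le]
  congr 1
  field_simp

variable {Ω : Type*} [MeasurableSpace Ω] {P : Measure Ω} [IsProbabilityMeasure P]
  {U U' : Ω → EuclideanSpace ℝ (Fin n)} {V : Ω → EuclideanSpace ℝ (Fin k)}
  {p q : EuclideanSpace ℝ (Fin k) → EuclideanSpace ℝ (Fin n) → ℝ}

lemma HasPosCondDensity.ae_volume_pos (h : HasPosCondDensity P U V) (hp : HasCondDensity P U V p) :
    ∀ᵐ v ∂P.map V, ∀ᵐ u, 0 < p v u := by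
  obtain ⟨q, hq, hpos⟩ := h
  filter_upwards [hp.2, hq.2, hpos] with v h1 h2 h3
  filter_upwards [h1.ae_eq h2] with u hu
  exact hu ▸ h3 u

lemma HasPosCondDensity.ae_volume_absolutelyContinuous (h : HasPosCondDensity P U V) :
    ∀ᵐ v ∂P.map V, volume ≪ condDistrib U V P v := by
  obtain ⟨q, hq, hpos⟩ := h
  filter_upwards [hq.2, hpos] with v h1 h2
  exact h1.volume_absolutelyContinuous (Filter.Eventually.of_forall h2)

lemma HasCondDensity.ae_pos (hU : Measurable U) (hV : Measurable V)
    (hp : HasCondDensity P U V p) : ∀ᵐ ω ∂P, 0 < p (V ω) (U ω) := by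
  refine ae_of_ae_ae_condDistrib hV hU (s := {z | 0 < Function.uncurry p z})
    (measurableSet_lt measurable_const hp.1) ?_
  filter_upwards [hp.2] with v hv using hv.ae_pos

/-- Laws with positive conditional densities given `V` are equivalent jointly with `V`. -/
lemma HasPosCondDensity.map_prodMk_absolutelyContinuous (hU : Measurable U) (hU' : Measurable U')
    (h : HasPosCondDensity P U V) (h' : HasPosCondDensity P U' V) :
    P.map (fun ω => (V ω, U ω)) ≪ P.map (fun ω => (V ω, U' ω)) := by
  rw [← compProd_map_condDistrib hU.aemeasurable, ← compProd_map_condDistrib hU'.aemeasurable]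
  refine Measure.AbsolutelyContinuous.compProd_right ?_
  obtain ⟨q, hq, -⟩ := h
  filter_upwards [hq.2, h'.ae_volume_absolutelyContinuous] with v h1 h2
  exact h1.absolutelyContinuous.trans h2

lemma HasCondDensity.map_prodMk_eq_withDensity (hU : Measurable U)
    (hp : HasCondDensity P U V p) {pV : EuclideanSpace ℝ (Fin k) → ℝ}
    (hpV : HasDensity (P.map V) pV) :
    P.map (fun ω => (V ω, U ω)) = (volume.prod volume).withDensity
      (fun z => ENNReal.ofReal (pV z.1) * ENNReal.ofReal (p z.1 z.2)) := by
  have hpm : Measurable fun z : EuclideanSpace ℝ (Fin k) × EuclideanSpace ℝ (Fin n) =>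
      ENNReal.ofReal (p z.1 z.2) := hp.1.ennreal_ofReal
  have hm : Measurable fun z : EuclideanSpace ℝ (Fin k) × EuclideanSpace ℝ (Fin n) =>
      ENNReal.ofReal (pV z.1) * ENNReal.ofReal (p z.1 z.2) :=
    (hpV.1.ennreal_ofReal.comp measurable_fst).mul hpm
  refine Measure.ext_of_lintegral _ fun g hg => ?_
  rw [← compProd_map_condDistrib hU.aemeasurable, Measure.lintegral_compProd hg]
  have h1 : ∫⁻ v, ∫⁻ u, g (v, u) ∂condDistrib U V P v ∂P.map V =
      ∫⁻ v, (∫⁻ u, ENNReal.ofReal (p v u) * g (v, u)) ∂P.map V := by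
    refine lintegral_congr_ae ?_
    filter_upwards [hp.2] with v hv
    rw [hv.2.2]
    exact lintegral_withDensity_eq_lintegral_mul _ hv.1.ennreal_ofReal
      (hg.comp measurable_prodMk_left)
  have hpg : Measurable fun z : EuclideanSpace ℝ (Fin k) × EuclideanSpace ℝ (Fin n) =>
      ENNReal.ofReal (p z.1 z.2) * g z := hpm.mul hg
  rw [h1, hpV.2.2, lintegral_withDensity_eq_lintegral_mul _ hpV.1.ennreal_ofReal
    hpg.lintegral_prod_right', lintegral_withDensity_eq_lintegral_mul _ hm hg,
    lintegral_prod _ (hm.mul hg).aemeasurable]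
  refine lintegral_congr fun v => ?_
  refine (lintegral_const_mul _ (hpg.comp measurable_prodMk_left)).symm.trans ?_
  refine lintegral_congr fun u => ?_
  simp [mul_assoc]

/-- Bayes' formula, along a variable `W` whose joint law with `V` has a density and on which the
posterior density is positive. -/
lemma bayes_ae (hU : Measurable U) (hV : Measurable V)
    {pU : EuclideanSpace ℝ (Fin n) → ℝ} {pV : EuclideanSpace ℝ (Fin k) → ℝ}
    {pVU : EuclideanSpace ℝ (Fin n) → EuclideanSpace ℝ (Fin k) → ℝ}
    (hpU : HasDensity (P.map U) pU) (hpV : HasDensity (P.map V) pV)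
    (hpVU : HasCondDensity P V U pVU) (hp : HasCondDensity P U V p)
    {W : Ω → EuclideanSpace ℝ (Fin n)} (hW : Measurable W) (hq : HasCondDensity P W V q)
    (hpos : ∀ᵐ ω ∂P, 0 < p (V ω) (W ω)) :
    ∀ᵐ ω ∂P, 0 < pV (V ω) ∧ 0 < pU (W ω) ∧ 0 < pVU (W ω) (V ω) ∧
      pVU (W ω) (V ω) * pU (W ω) = pV (V ω) * p (V ω) (W ω) := by
  have h1 := hp.map_prodMk_eq_withDensity hU hpV
  have h2 := hpVU.map_prodMk_eq_withDensity hV hpU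
  have hm1 : Measurable fun z : EuclideanSpace ℝ (Fin k) × EuclideanSpace ℝ (Fin n) =>
      ENNReal.ofReal (pV z.1) * ENNReal.ofReal (p z.1 z.2) :=
    (hpV.1.ennreal_ofReal.comp measurable_fst).mul hp.1.ennreal_ofReal
  have hm2 : Measurable fun z : EuclideanSpace ℝ (Fin n) × EuclideanSpace ℝ (Fin k) =>
      ENNReal.ofReal (pU z.1) * ENNReal.ofReal (pVU z.1 z.2) :=
    (hpU.1.ennreal_ofReal.comp measurable_fst).mul hpVU.1.ennreal_ofReal
  have hm3 : Measurable fun z : EuclideanSpace ℝ (Fin k) × EuclideanSpace ℝ (Fin n) =>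
      ENNReal.ofReal (pU z.2) * ENNReal.ofReal (pVU z.2 z.1) := hm2.comp measurable_swap
  have h3 : P.map (fun ω => (V ω, U ω)) = (volume.prod volume).withDensity
      (fun z => ENNReal.ofReal (pU z.2) * ENNReal.ofReal (pVU z.2 z.1)) := by
    have : P.map (fun ω => (V ω, U ω)) = (P.map (fun ω => (U ω, V ω))).map Prod.swap := by
      rw [Measure.map_map measurable_swap (hU.prodMk hV)]; rfl
    rw [this, h2]
    refine Measure.ext_of_lintegral _ fun g hg => ?_
    rw [lintegral_map hg measurable_swap]
    have hgs : Measurable fun z : EuclideanSpace ℝ (Fin n) × EuclideanSpace ℝ (Fin k) =>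
      g z.swap := hg.comp measurable_swap
    have hl := lintegral_map (hm3.mul hg) measurable_swap (μ := (volume :
      Measure (EuclideanSpace ℝ (Fin n))).prod (volume : Measure (EuclideanSpace ℝ (Fin k))))
    rw [Measure.prod_swap] at hl
    rw [lintegral_withDensity_eq_lintegral_mul _ hm2 hgs,
      lintegral_withDensity_eq_lintegral_mul _ hm3 hg, hl]
    rfl
  rw [h1, withDensity_eq_iff_of_sigmaFinite hm1.aemeasurable
    hm3.aemeasurable] at h3
  have hac : P.map (fun ω => (V ω, W ω)) ≪ volume.prod volume := by
    rw [hq.map_prodMk_eq_withDensity hW hpV]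
    exact withDensity_absolutelyContinuous _ _
  have h4 := ae_of_ae_map (hV.prodMk hW).aemeasurable (hac.ae_le h3)
  have h5 := ae_of_ae_map hV.aemeasurable hpV.ae_pos
  filter_upwards [h4, h5, hpos] with ω e1 e2 e3
  have e4 : 0 < pV (V ω) * p (V ω) (W ω) := mul_pos e2 e3
  rw [← ENNReal.ofReal_mul (hpV.2.1 _), ← ENNReal.ofReal_mul (hpU.2.1 _)] at e1
  have e5 : 0 < pU (W ω) * pVU (W ω) (V ω) := by
    rwa [← ENNReal.ofReal_pos, ← e1, ENNReal.ofReal_pos]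
  have e6 : 0 < pU (W ω) := lt_of_le_of_ne (hpU.2.1 _) fun h => by simp [← h] at e5
  rw [ENNReal.ofReal_eq_ofReal_iff e4.le e5.le] at e1
  exact ⟨e2, e6, pos_of_mul_pos_right e5 e6.le, by rw [e1, mul_comm]⟩

end Density

/-! ### The density of the reverse path -/

section Flow

variable {Ω : Type*} [MeasurableSpace Ω] {P : Measure Ω} [IsProbabilityMeasure P] {d m T : ℕ}
  {X : Ω → EuclideanSpace ℝ (Fin d)} {Y : Ω → EuclideanSpace ℝ (Fin m)}
  {Xp Yr : Fin (T + 1) → Ω → EuclideanSpace ℝ (Fin d)}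
  {p : Fin (T + 1) → EuclideanSpace ℝ (Fin m) → EuclideanSpace ℝ (Fin d) → ℝ}
  {q : EuclideanSpace ℝ (Fin m) → EuclideanSpace ℝ (Fin d) → ℝ}
  {f : Fin T → EuclideanSpace ℝ (Fin m) → EuclideanSpace ℝ (Fin d) →
      EuclideanSpace ℝ (Fin d) → ℝ}

/-- The end point of the reverse path follows the posterior. -/
lemma IsCondReverse.condDistrib_last (hYr : IsCondReverse P X Y Xp Yr) :
    condDistrib (Yr (Fin.last T)) Y P =ᵐ[P.map Y] condDistrib X Y P := by
  obtain ⟨R, hR, hchain, -⟩ := hYr.kernels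
  have hW : Measurable fun ω (t : Fin (T + 1)) => Yr t.rev ω :=
    measurable_pi_iff.2 fun t => hYr.measurable t.rev
  have h := condDistrib_comp (μ := P) (mβ := inferInstance) Y hW.aemeasurable
    (measurable_pi_apply (X := fun _ : Fin (T + 1) => EuclideanSpace ℝ (Fin d)) 0)
  filter_upwards [h, hchain] with y h1 h2
  rw [Kernel.map_apply _ (measurable_pi_apply _), h2, map_zero_chainMeasure] at h1
  rw [← h1]
  congr 1

/-- The steps of the reverse path have the density `f` with respect to the backward
conditional laws of the forward path, and this density is positive. -/
lemma IsCondReverse.exists_kernel (hY : Measurable Y) (hXp : IsCondSNF P Y Xp)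
    (hYr : IsCondReverse P X Y Xp Yr) (hf : IsBackwardRatio P Y Xp Yr f) :
    ∃ R : Fin T → Kernel (EuclideanSpace ℝ (Fin m) × EuclideanSpace ℝ (Fin d))
        (EuclideanSpace ℝ (Fin d)), (∀ t, IsMarkovKernel (R t)) ∧
      (∀ᵐ y ∂P.map Y, condDistrib (fun ω t => Yr (Fin.rev t) ω) Y P y =
        chainMeasure (condDistrib X Y P y) T (fun t => (R t.rev).sectR y)) ∧
      ∀ t, ∀ᵐ z ∂P.map (fun ω => (Y ω, Xp t.succ ω)),
        R t z = (condDistrib (Xp t.castSucc) (fun ω => (Y ω, Xp t.succ ω)) P z).withDensity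
          (fun x => ENNReal.ofReal (f t z.1 x z.2)) ∧
        ∀ᵐ x ∂condDistrib (Xp t.castSucc) (fun ω => (Y ω, Xp t.succ ω)) P z,
          0 < f t z.1 x z.2 := by
  obtain ⟨R, hR, hchain, hac⟩ := hYr.kernels
  refine ⟨R, hR, hchain, fun t => ?_⟩
  have hW : Measurable fun ω (t : Fin (T + 1)) => Yr t.rev ω :=
    measurable_pi_iff.2 fun t => hYr.measurable t.rev
  have hedge := condDistrib_edge_of_eq_chainMeasure hW (K := fun t => R t.rev) hchain t.rev
  simp only [Fin.rev_castSucc, Fin.rev_succ, Fin.rev_rev] at hedge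
  have hRY := condDistrib_eq_of_condDistrib_prodMk hY (hYr.measurable t.succ)
    (hYr.measurable t.castSucc) (R t) hedge
  -- both laws are equivalent to `P_Y ⊗ volume`, so null sets of one are null for the other
  have hll : P.map (fun ω => (Y ω, Xp t.succ ω)) ≪ P.map (fun ω => (Y ω, Yr t.succ ω)) :=
    (hXp.density t.succ).map_prodMk_absolutelyContinuous (hXp.measurable _) (hYr.measurable _)
      (hYr.density t.succ)
  filter_upwards [hac t, (hf t).2, hll.ae_le hRY] with z ⟨h1, h2⟩ h3 h4
  have h4' : condDistrib (Yr t.castSucc) (fun ω => (Y ω, Yr t.succ ω)) P z = R t z := h4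
  rw [h4'] at h3
  constructor
  · refine (Measure.withDensity_rnDeriv_eq _ _ h1).symm.trans ?_
    refine withDensity_congr_ae ?_
    filter_upwards [h3, Measure.rnDeriv_lt_top (R t z)
      (condDistrib (Xp t.castSucc) (fun ω => (Y ω, Xp t.succ ω)) P z)] with x hx hx'
    rw [hx, ENNReal.ofReal_toReal hx'.ne]
  · filter_upwards [h3, Measure.rnDeriv_lt_top (R t z)
      (condDistrib (Xp t.castSucc) (fun ω => (Y ω, Xp t.succ ω)) P z),
      Measure.rnDeriv_pos' h2] with x hx hx' hx''
    rw [hx]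
    exact ENNReal.toReal_pos hx''.ne' hx'.ne

/-- Positivity of the ratios comes from the absolute continuity of the backward conditional laws
with respect to the steps of the reverse path. -/
lemma ae_backwardRatio_pos (hY : Measurable Y) (hXp : IsCondSNF P Y Xp)
    (hYr : IsCondReverse P X Y Xp Yr) (hf : IsBackwardRatio P Y Xp Yr f) :
    ∀ᵐ ω ∂P, ∀ t, 0 < f t (Y ω) (Xp t.castSucc ω) (Xp t.succ ω) := by
  obtain ⟨R, -, -, h⟩ := hYr.exists_kernel hY hXp hf
  refine ae_all_iff.2 fun t => ?_
  have hm : Measurable fun z : (EuclideanSpace ℝ (Fin m) × EuclideanSpace ℝ (Fin d)) ×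
      EuclideanSpace ℝ (Fin d) => f t z.1.1 z.2 z.1.2 :=
    (hf t).1.comp ((measurable_fst.comp measurable_fst).prodMk
      (measurable_snd.prodMk (measurable_snd.comp measurable_fst)))
  exact ae_of_ae_ae_condDistrib (hY.prodMk (hXp.measurable t.succ)) (hXp.measurable t.castSucc)
    (s := {z | 0 < f t z.1.1 z.2 z.1.2}) (measurableSet_lt measurable_const hm)
    (by filter_upwards [h t] with z hz using hz.2)

/-- The density of the joint law of `Y` and the reverse path with respect to that of `Y` and the
forward path. Here `q` is the posterior density, `pT` the density of the end point of the forward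
path, and every factor goes through `ENNReal.ofReal` since `f` need only be nonnegative almost
everywhere. -/
noncomputable def pathDensity (q pT : EuclideanSpace ℝ (Fin m) → EuclideanSpace ℝ (Fin d) → ℝ)
    (f : Fin T → EuclideanSpace ℝ (Fin m) → EuclideanSpace ℝ (Fin d) →
      EuclideanSpace ℝ (Fin d) → ℝ)
    (z : EuclideanSpace ℝ (Fin m) × (Fin (T + 1) → EuclideanSpace ℝ (Fin d))) : ℝ≥0∞ :=
  ENNReal.ofReal (q z.1 (z.2 (Fin.last T)) / pT z.1 (z.2 (Fin.last T))) *
    ∏ t, ENNReal.ofReal (f t z.1 (z.2 t.castSucc) (z.2 t.succ))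

lemma measurable_backwardRatio (hf : IsBackwardRatio P Y Xp Yr f) (t : Fin T) :
    Measurable fun z : EuclideanSpace ℝ (Fin m) × (Fin (T + 1) → EuclideanSpace ℝ (Fin d)) =>
      f t z.1 (z.2 t.castSucc) (z.2 t.succ) := by
  have h : Measurable fun z : EuclideanSpace ℝ (Fin m) × (Fin (T + 1) →
      EuclideanSpace ℝ (Fin d)) => (z.1, z.2 t.castSucc, z.2 t.succ) :=
    measurable_fst.prodMk (((measurable_pi_apply _).comp measurable_snd).prodMk
      ((measurable_pi_apply _).comp measurable_snd))
  exact (hf t).1.comp h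

lemma measurable_uncurry_eval
    {q : EuclideanSpace ℝ (Fin m) → EuclideanSpace ℝ (Fin d) → ℝ}
    (hq : Measurable (Function.uncurry q)) (s : Fin (T + 1)) :
    Measurable fun z : EuclideanSpace ℝ (Fin m) × (Fin (T + 1) → EuclideanSpace ℝ (Fin d)) =>
      q z.1 (z.2 s) := by
  have h : Measurable fun z : EuclideanSpace ℝ (Fin m) × (Fin (T + 1) →
      EuclideanSpace ℝ (Fin d)) => (z.1, z.2 s) :=
    measurable_fst.prodMk ((measurable_pi_apply _).comp measurable_snd)
  exact hq.comp h

lemma measurable_pathDensity {q pT : EuclideanSpace ℝ (Fin m) → EuclideanSpace ℝ (Fin d) → ℝ}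
    (hq : Measurable (Function.uncurry q)) (hp : Measurable (Function.uncurry pT))
    (hf : IsBackwardRatio P Y Xp Yr f) : Measurable (pathDensity (T := T) q pT f) := by
  unfold pathDensity
  refine ((measurable_uncurry_eval hq _).div
    (measurable_uncurry_eval hp _)).ennreal_ofReal.mul ?_
  exact Finset.measurable_prod _ fun t _ => (measurable_backwardRatio hf t).ennreal_ofReal

/-- Given almost every value of `Y`, the reverse path has density `pathDensity` with respect to the
forward path. -/
lemma condDistrib_reverse_eq_withDensity (hY : Measurable Y) (hXp : IsCondSNF P Y Xp)
    (hYr : IsCondReverse P X Y Xp Yr) (hf : IsBackwardRatio P Y Xp Yr f)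
    (hp : HasCondDensity P (Xp (Fin.last T)) Y (p (Fin.last T))) (hq : HasCondDensity P X Y q) :
    ∀ᵐ y ∂P.map Y, condDistrib (fun ω t => Yr t ω) Y P y =
      (condDistrib (fun ω t => Xp t ω) Y P y).withDensity
        (fun x => pathDensity q (p (Fin.last T)) f (y, x)) := by
  obtain ⟨K, hK, hKchain⟩ := hXp.kernels
  obtain ⟨R, hR, hRchain, hRd⟩ := hYr.exists_kernel hY hXp hf
  have hXm : Measurable fun ω t => Xp t ω := measurable_pi_iff.2 hXp.measurable
  have hW : Measurable fun ω (t : Fin (T + 1)) => Yr t.rev ω :=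
    measurable_pi_iff.2 fun t => hYr.measurable t.rev
  have hrev := condDistrib_comp (μ := P) (mβ := inferInstance) Y hW.aemeasurable
    (measurable_finRev (E := EuclideanSpace ℝ (Fin d)) (T + 1))
  have hmarg : ∀ᵐ y ∂P.map Y, ∀ s, (condDistrib (fun ω t => Xp t ω) Y P y).map (fun x => x s) =
      condDistrib (Xp s) Y P y := by
    refine ae_all_iff.2 fun s => ?_
    filter_upwards [condDistrib_comp (μ := P) (mβ := inferInstance) Y hXm.aemeasurable
      (measurable_pi_apply (X := fun _ : Fin (T + 1) => EuclideanSpace ℝ (Fin d)) s)] with y hy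
    rw [Kernel.map_apply _ (measurable_pi_apply _)] at hy
    exact hy.symm
  have hback : ∀ᵐ y ∂P.map Y, ∀ t : Fin T,
      (condDistrib (fun ω t => Xp t ω) Y P y).map (fun x => (x t.succ, x t.castSucc)) =
      condDistrib (Xp t.succ) Y P y ⊗ₘ
        (condDistrib (Xp t.castSucc) (fun ω => (Y ω, Xp t.succ ω)) P).sectR y := by
    refine ae_all_iff.2 fun t => ?_
    have hpm : Measurable fun x : Fin (T + 1) → EuclideanSpace ℝ (Fin d) =>
        (x t.succ, x t.castSucc) := (measurable_pi_apply _).prodMk (measurable_pi_apply _)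
    filter_upwards [condDistrib_comp (μ := P) (mβ := inferInstance) Y hXm.aemeasurable hpm,
      condDistrib_prodMk hY (hXp.measurable t.succ) (hXp.measurable t.castSucc)] with y h1 h2
    rw [Kernel.map_apply _ hpm] at h1
    rw [← h1, ← h2]
    rfl
  have hsteps : ∀ᵐ y ∂P.map Y, ∀ t : Fin T, ∀ᵐ x ∂condDistrib (Xp t.succ) Y P y,
      R t (y, x) = (condDistrib (Xp t.castSucc) (fun ω => (Y ω, Xp t.succ ω)) P
        (y, x)).withDensity (fun x' => ENNReal.ofReal (f t y x' x)) := by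
    refine ae_all_iff.2 fun t => ?_
    have := ae_ae_condDistrib (hXp.measurable t.succ) ((hRd t).mono fun z hz => hz.1)
    exact this
  filter_upwards [hKchain, hRchain, hrev, hmarg, hback, hsteps, hp.2, hq.2,
    (hXp.density (Fin.last T)).ae_volume_pos hp] with y h1 h2 h3 h4 h5 h6 h7 h8 h9
  have hff : ∀ t, Measurable (Function.uncurry fun x x' => ENNReal.ofReal (f t y x' x)) := by
    intro t
    have : Measurable fun z : EuclideanSpace ℝ (Fin d) × EuclideanSpace ℝ (Fin d) =>
        f t y z.2 z.1 :=
      (hf t).1.comp (measurable_const.prodMk (measurable_snd.prodMk measurable_fst))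
    exact this.ennreal_ofReal
  have key := map_rev_chainMeasure_eq_withDensity T (fun s => condDistrib (Xp s) Y P y)
    (fun t => (K t).sectR y)
    (fun t => (condDistrib (Xp t.castSucc) (fun ω => (Y ω, Xp t.succ ω)) P).sectR y)
    (fun t => (R t).sectR y) h1 h4 h5 (h8.1.div h7.1).ennreal_ofReal
    (h7.eq_withDensity_div h8 h9) hff h6
  rw [Kernel.map_apply _ (measurable_finRev _), h2, key] at h3
  have hid : (fun x : Fin (T + 1) → EuclideanSpace ℝ (Fin d) => fun i => x i.rev) ∘
      (fun ω (t : Fin (T + 1)) => Yr t.rev ω) = fun ω t => Yr t ω := by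
    ext ω t
    simp
  rw [hid] at h3
  exact h3

lemma map_reverse_eq_withDensity (hY : Measurable Y) (hXp : IsCondSNF P Y Xp)
    (hYr : IsCondReverse P X Y Xp Yr) (hf : IsBackwardRatio P Y Xp Yr f)
    (hp : HasCondDensity P (Xp (Fin.last T)) Y (p (Fin.last T))) (hq : HasCondDensity P X Y q) :
    P.map (fun ω => (Y ω, fun t => Yr t ω)) =
      (P.map (fun ω => (Y ω, fun t => Xp t ω))).withDensity
        (pathDensity q (p (Fin.last T)) f) := by
  have hXm : Measurable fun ω t => Xp t ω := measurable_pi_iff.2 hXp.measurable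
  have hYm : Measurable fun ω t => Yr t ω := measurable_pi_iff.2 hYr.measurable
  have hD := measurable_pathDensity hq.1 hp.1 hf
  refine Measure.ext_of_lintegral _ fun g hg => ?_
  rw [lintegral_withDensity_eq_lintegral_mul _ hD hg,
    ← compProd_map_condDistrib hXm.aemeasurable, ← compProd_map_condDistrib hYm.aemeasurable,
    Measure.lintegral_compProd hg, Measure.lintegral_compProd (hD.mul hg)]
  refine lintegral_congr_ae ?_
  filter_upwards [condDistrib_reverse_eq_withDensity hY hXp hYr hf hp hq] with y hy
  rw [hy]
  exact lintegral_withDensity_eq_lintegral_mul _ (hD.comp measurable_prodMk_left)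
    (hg.comp measurable_prodMk_left)

end Flow

/-! ### The log-likelihood ratio of the paths -/

section LogLikelihood

lemma Fin.sum_castSucc_sub_succ {T : ℕ} (a : Fin (T + 1) → ℝ) :
    ∑ t : Fin T, (a t.castSucc - a t.succ) = a 0 - a (Fin.last T) := by
  induction T with
  | zero => simp
  | succ T ih =>
    rw [Fin.sum_univ_castSucc]
    have := ih fun t => a t.castSucc
    simp only [Fin.succ_castSucc, Fin.castSucc_zero] at this ⊢
    rw [this]
    simp

variable {Ω : Type*} [MeasurableSpace Ω] {P : Measure Ω} [IsProbabilityMeasure P] {d m T : ℕ}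
  {X : Ω → EuclideanSpace ℝ (Fin d)} {Y : Ω → EuclideanSpace ℝ (Fin m)}
  {Xp Yr : Fin (T + 1) → Ω → EuclideanSpace ℝ (Fin d)}
  {p : Fin (T + 1) → EuclideanSpace ℝ (Fin m) → EuclideanSpace ℝ (Fin d) → ℝ}
  {q : EuclideanSpace ℝ (Fin m) → EuclideanSpace ℝ (Fin d) → ℝ}
  {f : Fin T → EuclideanSpace ℝ (Fin m) → EuclideanSpace ℝ (Fin d) →
      EuclideanSpace ℝ (Fin d) → ℝ}

/-- The posterior density is positive along the end point of the forward path. -/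
lemma ae_posterior_pos (hY : Measurable Y) (hXp : IsCondSNF P Y Xp)
    (hYr : IsCondReverse P X Y Xp Yr) (hq : HasCondDensity P X Y q) :
    ∀ᵐ ω ∂P, 0 < q (Y ω) (Xp (Fin.last T) ω) := by
  have hq' : HasCondDensity P (Yr (Fin.last T)) Y q := by
    refine ⟨hq.1, ?_⟩
    filter_upwards [hq.2, hYr.condDistrib_last] with y h1 h2
    rwa [h2]
  obtain ⟨r, hr, -⟩ := hXp.density (Fin.last T)
  refine ae_of_ae_ae_condDistrib hY (hXp.measurable _) (s := {z | 0 < Function.uncurry q z})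
    (measurableSet_lt measurable_const hq.1) ?_
  filter_upwards [(hYr.density (Fin.last T)).ae_volume_pos hq', hr.2] with y h1 h2
  exact h2.absolutelyContinuous.ae_le h1

lemma ae_pathDensity_pos (hY : Measurable Y) (hXp : IsCondSNF P Y Xp)
    (hYr : IsCondReverse P X Y Xp Yr) (hf : IsBackwardRatio P Y Xp Yr f)
    (hp : HasCondDensity P (Xp (Fin.last T)) Y (p (Fin.last T))) (hq : HasCondDensity P X Y q) :
    ∀ᵐ z ∂P.map (fun ω => (Y ω, fun t => Xp t ω)),
      pathDensity q (p (Fin.last T)) f z ≠ 0 := by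
  have hD := measurable_pathDensity hq.1 hp.1 hf
  have hm : Measurable fun ω => (Y ω, fun t => Xp t ω) :=
    hY.prodMk (measurable_pi_iff.2 hXp.measurable)
  refine (ae_map_iff hm.aemeasurable (hD (measurableSet_singleton 0)).compl).2 ?_
  filter_upwards [ae_posterior_pos hY hXp hYr hq, hp.ae_pos (hXp.measurable _) hY,
    ae_backwardRatio_pos hY hXp hYr hf] with ω h1 h2 h3
  unfold pathDensity
  refine mul_ne_zero ?_ (Finset.prod_ne_zero_iff.2 fun t _ => ?_)
  · simpa using div_pos h1 h2
  · simpa using h3 t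

/-- The laws of the forward and of the reverse path are equivalent. -/
lemma map_path_absolutelyContinuous (hY : Measurable Y) (hXp : IsCondSNF P Y Xp)
    (hYr : IsCondReverse P X Y Xp Yr) (hf : IsBackwardRatio P Y Xp Yr f)
    (hp : HasCondDensity P (Xp (Fin.last T)) Y (p (Fin.last T))) (hq : HasCondDensity P X Y q) :
    P.map (fun ω => (Y ω, fun t => Xp t ω)) ≪ P.map (fun ω => (Y ω, fun t => Yr t ω)) ∧
      P.map (fun ω => (Y ω, fun t => Yr t ω)) ≪ P.map (fun ω => (Y ω, fun t => Xp t ω)) := by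
  rw [map_reverse_eq_withDensity hY hXp hYr hf hp hq]
  exact ⟨withDensity_absolutelyContinuous' (measurable_pathDensity hq.1 hp.1 hf).aemeasurable
    (ae_pathDensity_pos hY hXp hYr hf hp hq), withDensity_absolutelyContinuous _ _⟩

/-- The log-likelihood ratio of the paths: inserting the densities `p t` telescopes. -/
lemma llr_reverse_ae_eq (hY : Measurable Y) (hXp : IsCondSNF P Y Xp)
    (hYr : IsCondReverse P X Y Xp Yr) (hf : IsBackwardRatio P Y Xp Yr f)
    (hp : ∀ t, HasCondDensity P (Xp t) Y (p t)) (hq : HasCondDensity P X Y q)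
    {pZ : EuclideanSpace ℝ (Fin d) → ℝ} (hpm : Measurable pZ)
    (hpZ : ∀ᵐ y ∂P.map Y, HasDensity (condDistrib (Xp 0) Y P y) pZ) :
    ∀ᵐ ω ∂P, llr (P.map (fun ω => (Y ω, fun t => Yr t ω)))
        (P.map (fun ω => (Y ω, fun t => Xp t ω))) (Y ω, fun t => Xp t ω) =
      Real.log (q (Y ω) (Xp (Fin.last T) ω)) - Real.log (pZ (Xp 0 ω)) +
        ∑ t : Fin T, Real.log (f t (Y ω) (Xp t.castSucc ω) (Xp t.succ ω)
          * p t.castSucc (Y ω) (Xp t.castSucc ω) / p t.succ (Y ω) (Xp t.succ ω)) := by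
  have hm : Measurable fun ω => (Y ω, fun t => Xp t ω) :=
    hY.prodMk (measurable_pi_iff.2 hXp.measurable)
  have hD := measurable_pathDensity hq.1 (hp (Fin.last T)).1 hf
  have hZ : ∀ᵐ ω ∂P, p 0 (Y ω) (Xp 0 ω) = pZ (Xp 0 ω) := by
    refine ae_of_ae_ae_condDistrib hY (hXp.measurable 0)
      (s := {z | Function.uncurry (p 0) z = pZ z.2})
      (measurableSet_eq_fun (hp 0).1 (hpm.comp measurable_snd)) ?_
    filter_upwards [hpZ, (hp 0).2] with y h1 h2
    exact h2.absolutelyContinuous.ae_le (h2.ae_eq h1)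
  have hrn := Measure.rnDeriv_withDensity (P.map (fun ω => (Y ω, fun t => Xp t ω))) hD
  rw [← map_reverse_eq_withDensity hY hXp hYr hf (hp (Fin.last T)) hq] at hrn
  filter_upwards [ae_of_ae_map hm.aemeasurable hrn, hZ, ae_posterior_pos hY hXp hYr hq,
    ae_all_iff.2 fun s => (hp s).ae_pos (hXp.measurable s) hY,
    ae_backwardRatio_pos hY hXp hYr hf] with ω h1 h2 h3 h4 h5
  have hsum : ∀ t : Fin T, Real.log (f t (Y ω) (Xp t.castSucc ω) (Xp t.succ ω)
      * p t.castSucc (Y ω) (Xp t.castSucc ω) / p t.succ (Y ω) (Xp t.succ ω)) =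
      Real.log (f t (Y ω) (Xp t.castSucc ω) (Xp t.succ ω)) +
        (Real.log (p t.castSucc (Y ω) (Xp t.castSucc ω)) -
          Real.log (p t.succ (Y ω) (Xp t.succ ω))) := by
    intro t
    rw [Real.log_div (mul_pos (h5 t) (h4 _)).ne' (h4 _).ne', Real.log_mul (h5 t).ne' (h4 _).ne']
    ring
  rw [llr, h1, Finset.sum_congr rfl fun t _ => hsum t, Finset.sum_add_distrib,
    Fin.sum_castSucc_sub_succ (fun s => Real.log (p s (Y ω) (Xp s ω))), h2]
  unfold pathDensity
  rw [ENNReal.toReal_mul, ENNReal.toReal_ofReal (div_pos h3 (h4 _)).le, ENNReal.toReal_prod,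
    Finset.prod_congr rfl fun t _ => ENNReal.toReal_ofReal (h5 t).le,
    Real.log_mul (div_pos h3 (h4 _)).ne' (Finset.prod_pos fun t _ => h5 t).ne',
    Real.log_div h3.ne' (h4 _).ne', Real.log_prod fun t _ => (h5 t).ne']
  ring

end LogLikelihood

/-! ### Additive independent noise -/

section Noise

/-- The conditional law of `F (X) + η` given `X`, for a noise independent of `X`. -/
lemma condDistrib_add_noise {Ω : Type*} [MeasurableSpace Ω] {P : Measure Ω}
    [IsProbabilityMeasure P] {d m : ℕ} {X : Ω → EuclideanSpace ℝ (Fin d)} (hX : Measurable X)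
    {F : EuclideanSpace ℝ (Fin d) → EuclideanSpace ℝ (Fin m)} (hF : Measurable F)
    {η : Ω → EuclideanSpace ℝ (Fin m)} (hη : Measurable η) (h : IndepFun X η P) :
    ∀ᵐ x ∂P.map X, condDistrib (fun ω => F (X ω) + η ω) X P x =
      (P.map η).map (fun e => F x + e) := by
  have hadd : Measurable fun z : EuclideanSpace ℝ (Fin d) × EuclideanSpace ℝ (Fin m) =>
    F z.1 + z.2 := (hF.comp measurable_fst).add measurable_snd
  have := Measure.isProbabilityMeasure_map (μ := P) hη.aemeasurable
  let κ : Kernel (EuclideanSpace ℝ (Fin d)) (EuclideanSpace ℝ (Fin m)) :=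
    (Kernel.id ×ₖ Kernel.const _ (P.map η)).map (fun z => F z.1 + z.2)
  have : IsMarkovKernel κ := Kernel.IsMarkovKernel.map _ hadd
  have hκ : ∀ x, κ x = (P.map η).map (fun e => F x + e) := by
    intro x
    refine Measure.ext_of_lintegral _ fun g hg => ?_
    have hga : Measurable fun z : EuclideanSpace ℝ (Fin d) × EuclideanSpace ℝ (Fin m) =>
      g (F z.1 + z.2) := hg.comp hadd
    rw [Kernel.map_apply _ hadd, Kernel.prod_apply, lintegral_map hg hadd,
      lintegral_map hg (measurable_const_add _), Kernel.id_apply, Kernel.const_apply,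
      lintegral_prod _ hga.aemeasurable, lintegral_dirac']
    exact hga.lintegral_prod_right'
  have heq : P.map (fun ω => (X ω, F (X ω) + η ω)) = P.map X ⊗ₘ κ := by
    refine Measure.ext_of_lintegral _ fun g hg => ?_
    have hm : Measurable fun z : EuclideanSpace ℝ (Fin d) × EuclideanSpace ℝ (Fin m) =>
      (z.1, F z.1 + z.2) := measurable_fst.prodMk hadd
    have h1 : P.map (fun ω => (X ω, F (X ω) + η ω)) =
        ((P.map X).prod (P.map η)).map (fun z => (z.1, F z.1 + z.2)) := by
      rw [← (indepFun_iff_map_prod_eq_prod_map_map hX.aemeasurable hη.aemeasurable).1 h,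
        Measure.map_map hm (hX.prodMk hη)]
      rfl
    have hgm : Measurable fun z : EuclideanSpace ℝ (Fin d) × EuclideanSpace ℝ (Fin m) =>
      g (z.1, F z.1 + z.2) := hg.comp hm
    rw [h1, lintegral_map hg hm, lintegral_prod _ hgm.aemeasurable,
      Measure.lintegral_compProd hg]
    refine lintegral_congr fun x => ?_
    rw [hκ]
    exact (lintegral_map (f := fun e => g (x, e)) (hg.comp measurable_prodMk_left)
      (measurable_const_add (F x))).symm
  filter_upwards [condDistrib_ae_eq_of_measure_eq_compProd X
    (hX.prodMk hη |> hadd.comp).aemeasurable heq] with x hx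
  exact hx.trans (hκ x)

lemma HasDensity.map_add_left {n : ℕ} {μ : Measure (EuclideanSpace ℝ (Fin n))}
    {p : EuclideanSpace ℝ (Fin n) → ℝ} (h : HasDensity μ p) (a : EuclideanSpace ℝ (Fin n)) :
    HasDensity (μ.map (fun e => a + e)) (fun y => p (y - a)) := by
  have hm : Measurable fun y => p (y - a) := h.1.comp (measurable_id.sub_const a)
  refine ⟨hm, fun y => h.2.1 _, ?_⟩
  refine Measure.ext_of_lintegral _ fun g hg => ?_
  have hga : Measurable fun e => g (a + e) := hg.comp (measurable_const_add _)
  rw [lintegral_map hg (measurable_const_add _), h.2.2,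
    lintegral_withDensity_eq_lintegral_mul _ h.1.ennreal_ofReal hga,
    lintegral_withDensity_eq_lintegral_mul _ hm.ennreal_ofReal hg,
    ← lintegral_add_left_eq_self ((fun y => ENNReal.ofReal (p (y - a))) * g) a]
  simp

end Noise

/-! ### Divergences between the paths and the likelihood -/

section Divergence

variable {Ω : Type*} [MeasurableSpace Ω] {P : Measure Ω} [IsProbabilityMeasure P] {d m T : ℕ}
  {X Z : Ω → EuclideanSpace ℝ (Fin d)} {Y : Ω → EuclideanSpace ℝ (Fin m)}
  {Xp Yr : Fin (T + 1) → Ω → EuclideanSpace ℝ (Fin d)}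
  {p : Fin (T + 1) → EuclideanSpace ℝ (Fin m) → EuclideanSpace ℝ (Fin d) → ℝ}
  {f : Fin T → EuclideanSpace ℝ (Fin m) → EuclideanSpace ℝ (Fin d) →
      EuclideanSpace ℝ (Fin d) → ℝ}
  {pZ : EuclideanSpace ℝ (Fin d) → ℝ}

/-- The divergence between two path laws given `Y`, as an iterated extended expectation. The
hypothesis on the log-likelihood ratio is imposed along the path `W` on `Ω`. -/
lemma coe_klDiv_path_eq (hY : Measurable Y) {W W' : Fin (T + 1) → Ω → EuclideanSpace ℝ (Fin d)}
    (hW : ∀ t, Measurable (W t)) (hW' : ∀ t, Measurable (W' t))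
    (hac : P.map (fun ω => (Y ω, fun t => W t ω)) ≪ P.map (fun ω => (Y ω, fun t => W' t ω)))
    {g h : EuclideanSpace ℝ (Fin m) × (Fin (T + 1) → EuclideanSpace ℝ (Fin d)) → ℝ}
    (hg : Measurable g) (hh : Measurable h)
    (hint : Integrable (fun ω => h (Y ω, fun t => W t ω)) P)
    (hgh : ∀ᵐ z ∂P.map (fun ω => (Y ω, fun t => W t ω)),
      llr (P.map (fun ω => (Y ω, fun t => W t ω))) (P.map (fun ω => (Y ω, fun t => W' t ω))) z =
        g z + h z) :
    (InformationTheory.klDiv (P.map (fun ω => (Y ω, fun t => W t ω)))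
        (P.map (fun ω => (Y ω, fun t => W' t ω))) : EReal) =
      eexpect (P.map Y) (fun y => eexpect (condDistrib (fun ω t => W t ω) Y P y)
        (fun x => (g (y, x) : EReal)))
        + ((∫ ω, h (Y ω, fun t => W t ω) ∂P : ℝ) : EReal) := by
  have hWm : Measurable fun ω t => W t ω := measurable_pi_iff.2 hW
  have hm := hY.prodMk hWm
  have hm' : Measurable fun ω => (Y ω, fun t => W' t ω) := hY.prodMk (measurable_pi_iff.2 hW')
  have := Measure.isProbabilityMeasure_map (μ := P) hY.aemeasurable
  have := Measure.isProbabilityMeasure_map (μ := P) hm'.aemeasurable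
  have hint' := (integrable_map_measure hh.aestronglyMeasurable hm.aemeasurable).2 hint
  have hI := integral_map (μ := P) hm.aemeasurable hh.aestronglyMeasurable
  rw [← hI]
  rw [← compProd_map_condDistrib hWm.aemeasurable] at hac hgh hint' ⊢
  exact coe_klDiv_eq_iterated hac hg hint' hgh

lemma measurable_snd_eval (s : Fin (T + 1)) :
    Measurable fun z : EuclideanSpace ℝ (Fin m) × (Fin (T + 1) → EuclideanSpace ℝ (Fin d)) =>
      z.2 s := (measurable_pi_apply s).comp measurable_snd

lemma measurable_pathSum (hp : ∀ t, HasCondDensity P (Xp t) Y (p t))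
    (hf : IsBackwardRatio P Y Xp Yr f) :
    Measurable fun z : EuclideanSpace ℝ (Fin m) × (Fin (T + 1) → EuclideanSpace ℝ (Fin d)) =>
      ∑ t : Fin T, Real.log (f t z.1 (z.2 t.castSucc) (z.2 t.succ)
        * p t.castSucc z.1 (z.2 t.castSucc) / p t.succ z.1 (z.2 t.succ)) :=
  Finset.measurable_sum _ fun t _ => Real.measurable_log.comp
    (((measurable_backwardRatio hf t).mul (measurable_uncurry_eval (hp _).1 _)).div
      (measurable_uncurry_eval (hp _).1 _))

/-- The divergence of the reverse path from the forward path. -/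
lemma klDiv_reverse_forward (hY : Measurable Y) (hX : Measurable X) (hpZ : HasDensity (P.map Z) pZ)
    (hXp : IsCondSNF P Y Xp) (hYr : IsCondReverse P X Y Xp Yr)
    (hX0 : ∀ᵐ y ∂(P.map Y), condDistrib (Xp 0) Y P y = P.map Z)
    (hp : ∀ t, HasCondDensity P (Xp t) Y (p t)) (hf : IsBackwardRatio P Y Xp Yr f)
    {q : EuclideanSpace ℝ (Fin m) → EuclideanSpace ℝ (Fin d) → ℝ}
    (hq : HasCondDensity P X Y q)
    (hint : Integrable (fun z : EuclideanSpace ℝ (Fin m) × EuclideanSpace ℝ (Fin d) =>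
        Real.log (q z.1 z.2)) (P.map (fun ω => (Y ω, X ω)))) :
    (InformationTheory.klDiv (P.map (fun ω => (Y ω, fun t => Yr t ω)))
        (P.map (fun ω => (Y ω, fun t => Xp t ω))) : EReal) =
      eexpect (P.map Y) (fun y =>
        eexpect (condDistrib (fun ω t => Yr t ω) Y P y) (fun x =>
          ((-Real.log (pZ (x 0))
            + ∑ t : Fin T, Real.log (f t y (x t.castSucc) (x t.succ)
                * p t.castSucc y (x t.castSucc) / p t.succ y (x t.succ)) : ℝ) : EReal)))
      + ((∫ z, Real.log (q z.1 z.2) ∂(P.map (fun ω => (Y ω, X ω))) : ℝ) : EReal) := by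
  have hlaw : P.map (fun ω => (Y ω, Yr (Fin.last T) ω)) = P.map (fun ω => (Y ω, X ω)) := by
    rw [← compProd_map_condDistrib hX.aemeasurable,
      ← compProd_map_condDistrib (hYr.measurable _).aemeasurable]
    exact Measure.compProd_congr hYr.condDistrib_last
  have hmT : Measurable fun ω => (Y ω, Yr (Fin.last T) ω) := hY.prodMk (hYr.measurable _)
  have hqm : Measurable fun z : EuclideanSpace ℝ (Fin m) × EuclideanSpace ℝ (Fin d) =>
    Real.log (q z.1 z.2) := Real.measurable_log.comp hq.1
  have hhm : Measurable fun z : EuclideanSpace ℝ (Fin m) ×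
      (Fin (T + 1) → EuclideanSpace ℝ (Fin d)) => Real.log (q z.1 (z.2 (Fin.last T))) :=
    Real.measurable_log.comp (measurable_uncurry_eval hq.1 _)
  have hZm : Measurable fun z : EuclideanSpace ℝ (Fin m) ×
      (Fin (T + 1) → EuclideanSpace ℝ (Fin d)) => Real.log (pZ (z.2 0)) :=
    Real.measurable_log.comp (hpZ.1.comp (measurable_snd_eval 0))
  have hgm : Measurable fun z : EuclideanSpace ℝ (Fin m) ×
      (Fin (T + 1) → EuclideanSpace ℝ (Fin d)) =>
      -Real.log (pZ (z.2 0)) + ∑ t : Fin T, Real.log (f t z.1 (z.2 t.castSucc) (z.2 t.succ)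
        * p t.castSucc z.1 (z.2 t.castSucc) / p t.succ z.1 (z.2 t.succ)) :=
    hZm.neg.add (measurable_pathSum hp hf)
  have hpZc : ∀ᵐ y ∂P.map Y, HasDensity (condDistrib (Xp 0) Y P y) pZ :=
    hX0.mono fun y hy => hy ▸ hpZ
  obtain ⟨-, hac⟩ := map_path_absolutelyContinuous hY hXp hYr hf (hp _) hq
  have hm : Measurable fun ω => (Y ω, fun t => Xp t ω) :=
    hY.prodMk (measurable_pi_iff.2 hXp.measurable)
  rw [← hlaw] at hint ⊢
  rw [integral_map hmT.aemeasurable hqm.aestronglyMeasurable]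
  rw [integrable_map_measure hqm.aestronglyMeasurable hmT.aemeasurable] at hint
  refine coe_klDiv_path_eq hY hYr.measurable hXp.measurable hac (g := fun z =>
    -Real.log (pZ (z.2 0)) + ∑ t : Fin T, Real.log (f t z.1 (z.2 t.castSucc) (z.2 t.succ)
        * p t.castSucc z.1 (z.2 t.castSucc) / p t.succ z.1 (z.2 t.succ))) hgm hhm hint ?_
  -- the log-likelihood ratio is known along the forward path, whose law dominates
  refine hac.ae_le ((ae_map_iff hm.aemeasurable
    (measurableSet_eq_fun (measurable_llr _ _) (hgm.add hhm))).2 ?_)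
  filter_upwards [llr_reverse_ae_eq hY hXp hYr hf hp hq hpZ.1 hpZc] with ω hω
  rw [hω, Pi.add_apply]
  ring

/-- The divergence of the forward path from the reverse path. -/
lemma klDiv_forward_reverse (hY : Measurable Y) (hX : Measurable X) (hpZ : HasDensity (P.map Z) pZ)
    (hXp : IsCondSNF P Y Xp) (hYr : IsCondReverse P X Y Xp Yr)
    (hX0 : ∀ᵐ y ∂(P.map Y), condDistrib (Xp 0) Y P y = P.map Z)
    (hZ : Measurable Z)
    (hp : ∀ t, HasCondDensity P (Xp t) Y (p t)) (hf : IsBackwardRatio P Y Xp Yr f)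
    {pX : EuclideanSpace ℝ (Fin d) → ℝ} {pY : EuclideanSpace ℝ (Fin m) → ℝ}
    {pYX : EuclideanSpace ℝ (Fin d) → EuclideanSpace ℝ (Fin m) → ℝ}
    (hpX : HasDensity (P.map X) pX) (hpY : HasDensity (P.map Y) pY)
    (hpYX : HasCondDensity P Y X pYX)
    (hintZ : Integrable (fun z => Real.log (pZ z)) (P.map Z))
    (hintY : Integrable (fun y => Real.log (pY y)) (P.map Y)) :
    (InformationTheory.klDiv (P.map (fun ω => (Y ω, fun t => Xp t ω)))
        (P.map (fun ω => (Y ω, fun t => Yr t ω))) : EReal) =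
      eexpect (P.map Y) (fun y =>
        eexpect (condDistrib (fun ω t => Xp t ω) Y P y) (fun x =>
          ((-Real.log (pYX (x (Fin.last T)) y) - Real.log (pX (x (Fin.last T)))
            - ∑ t : Fin T, Real.log (f t y (x t.castSucc) (x t.succ)
                * p t.castSucc y (x t.castSucc) / p t.succ y (x t.succ)) : ℝ) : EReal)))
      + (((∫ z, Real.log (pZ z) ∂(P.map Z)) + ∫ y, Real.log (pY y) ∂(P.map Y) : ℝ) : EReal) := by
  -- the end point of the reverse path supplies a version `q` of the posterior density
  obtain ⟨q, hqr, -⟩ := hYr.density (Fin.last T)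
  have hq : HasCondDensity P X Y q := by
    refine ⟨hqr.1, ?_⟩
    filter_upwards [hqr.2, hYr.condDistrib_last] with y h1 h2
    rwa [← h2]
  have hlaw : P.map (Xp 0) = P.map Z := by
    have := Measure.isProbabilityMeasure_map (μ := P) hY.aemeasurable
    have := Measure.isProbabilityMeasure_map (μ := P) hZ.aemeasurable
    have h1 : P.map (fun ω => (Y ω, Xp 0 ω)) = (P.map Y).prod (P.map Z) := by
      rw [← compProd_map_condDistrib (hXp.measurable 0).aemeasurable, ← Measure.compProd_const]
      exact Measure.compProd_congr hX0
    have h2 : P.map (Xp 0) = (P.map (fun ω => (Y ω, Xp 0 ω))).map Prod.snd := by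
      rw [Measure.map_map measurable_snd (hY.prodMk (hXp.measurable 0))]
      rfl
    rw [h2, h1, Measure.map_snd_prod, measure_univ, one_smul]
  have hlZ : Measurable fun x => Real.log (pZ x) := Real.measurable_log.comp hpZ.1
  have hlY : Measurable fun y => Real.log (pY y) := Real.measurable_log.comp hpY.1
  have hhm : Measurable fun z : EuclideanSpace ℝ (Fin m) ×
      (Fin (T + 1) → EuclideanSpace ℝ (Fin d)) => Real.log (pZ (z.2 0)) + Real.log (pY z.1) :=
    (hlZ.comp (measurable_snd_eval 0)).add (hlY.comp measurable_fst)
  have hYXm : Measurable fun z : EuclideanSpace ℝ (Fin m) ×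
      (Fin (T + 1) → EuclideanSpace ℝ (Fin d)) => Real.log (pYX (z.2 (Fin.last T)) z.1) := by
    have : Measurable fun z : EuclideanSpace ℝ (Fin m) ×
        (Fin (T + 1) → EuclideanSpace ℝ (Fin d)) => (z.2 (Fin.last T), z.1) :=
      (measurable_snd_eval _).prodMk measurable_fst
    exact Real.measurable_log.comp (hpYX.1.comp this)
  have hXm : Measurable fun z : EuclideanSpace ℝ (Fin m) ×
      (Fin (T + 1) → EuclideanSpace ℝ (Fin d)) => Real.log (pX (z.2 (Fin.last T))) :=
    Real.measurable_log.comp (hpX.1.comp (measurable_snd_eval _))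
  have hgm : Measurable fun z : EuclideanSpace ℝ (Fin m) ×
      (Fin (T + 1) → EuclideanSpace ℝ (Fin d)) =>
      -Real.log (pYX (z.2 (Fin.last T)) z.1) - Real.log (pX (z.2 (Fin.last T))) -
      ∑ t : Fin T, Real.log (f t z.1 (z.2 t.castSucc) (z.2 t.succ)
        * p t.castSucc z.1 (z.2 t.castSucc) / p t.succ z.1 (z.2 t.succ)) :=
    (hYXm.neg.sub hXm).sub (measurable_pathSum hp hf)
  have hpZc : ∀ᵐ y ∂P.map Y, HasDensity (condDistrib (Xp 0) Y P y) pZ :=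
    hX0.mono fun y hy => hy ▸ hpZ
  obtain ⟨hac, -⟩ := map_path_absolutelyContinuous hY hXp hYr hf (hp _) hq
  have hm : Measurable fun ω => (Y ω, fun t => Xp t ω) :=
    hY.prodMk (measurable_pi_iff.2 hXp.measurable)
  have hmr : Measurable fun ω => (Y ω, fun t => Yr t ω) :=
    hY.prodMk (measurable_pi_iff.2 hYr.measurable)
  have := Measure.isProbabilityMeasure_map (μ := P) hm.aemeasurable
  have := Measure.isProbabilityMeasure_map (μ := P) hmr.aemeasurable
  rw [← hlaw] at hintZ ⊢
  rw [integral_map (hXp.measurable 0).aemeasurable hlZ.aestronglyMeasurable,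
    integral_map hY.aemeasurable hlY.aestronglyMeasurable]
  have hiZ : Integrable (fun ω => Real.log (pZ (Xp 0 ω))) P :=
    (integrable_map_measure hlZ.aestronglyMeasurable (hXp.measurable 0).aemeasurable).1 hintZ
  have hiY : Integrable (fun ω => Real.log (pY (Y ω))) P :=
    (integrable_map_measure hlY.aestronglyMeasurable hY.aemeasurable).1 hintY
  rw [← integral_add hiZ hiY]
  refine coe_klDiv_path_eq hY hXp.measurable hYr.measurable hac (g := fun z =>
    -Real.log (pYX (z.2 (Fin.last T)) z.1) - Real.log (pX (z.2 (Fin.last T))) -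
      ∑ t : Fin T, Real.log (f t z.1 (z.2 t.castSucc) (z.2 t.succ)
        * p t.castSucc z.1 (z.2 t.castSucc) / p t.succ z.1 (z.2 t.succ)))
    (h := fun z => Real.log (pZ (z.2 0)) + Real.log (pY z.1)) hgm hhm (hiZ.add hiY) ?_
  refine (ae_map_iff hm.aemeasurable
    (measurableSet_eq_fun (measurable_llr _ _) (hgm.add hhm))).2 ?_
  filter_upwards [llr_reverse_ae_eq hY hXp hYr hf hp hq hpZ.1 hpZc,
    ae_of_ae_map hm.aemeasurable (neg_llr hac),
    bayes_ae hX hY hpX hpY hpYX hq (hXp.measurable (Fin.last T)) (hp (Fin.last T))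
      (ae_posterior_pos hY hXp hYr hq), ae_posterior_pos hY hXp hYr hq]
    with ω h1 h2 ⟨h3, h4, h5, h6⟩ h7
  have h8 := congrArg Real.log h6
  rw [Real.log_mul h5.ne' h4.ne', Real.log_mul h3.ne' h7.ne'] at h8
  rw [h1, Pi.neg_apply] at h2
  rw [Pi.add_apply]
  linarith

lemma likelihood_eq_noise {X : Ω → EuclideanSpace ℝ (Fin d)} (hX : Measurable X)
    {F : EuclideanSpace ℝ (Fin d) → EuclideanSpace ℝ (Fin m)} (hF : Measurable F)
    {η Y : Ω → EuclideanSpace ℝ (Fin m)} (hη : Measurable η)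
    (hmodel : ∀ ω, Y ω = F (X ω) + η ω) {pη : EuclideanSpace ℝ (Fin m) → ℝ}
    {pYX : EuclideanSpace ℝ (Fin d) → EuclideanSpace ℝ (Fin m) → ℝ}
    (hind : IndepFun X η P) (hpη : HasDensity (P.map η) pη) (hpYX : HasCondDensity P Y X pYX) :
    ∀ᵐ x ∂P.map X, ∀ᵐ y, pYX x y = pη (y - F x) := by
  obtain rfl : Y = fun ω => F (X ω) + η ω := funext hmodel
  filter_upwards [condDistrib_add_noise hX hF hη hind, hpYX.2] with x h1 h2
  rw [h1] at h2
  exact h2.ae_eq (hpη.map_add_left (F x))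

end Divergence

theorem corollary1 {Ω : Type*} [MeasurableSpace Ω] (P : Measure Ω) [IsProbabilityMeasure P]
    {d m T : ℕ}
    (X : Ω → EuclideanSpace ℝ (Fin d)) (hX : Measurable X)
    (F : EuclideanSpace ℝ (Fin d) → EuclideanSpace ℝ (Fin m)) (hF : Measurable F)
    (η : Ω → EuclideanSpace ℝ (Fin m)) (hη : Measurable η)
    (Y : Ω → EuclideanSpace ℝ (Fin m)) (hY : Measurable Y)
    (hmodel : ∀ ω, Y ω = F (X ω) + η ω)
    (Z : Ω → EuclideanSpace ℝ (Fin d)) (hZ : Measurable Z)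
    (pZ : EuclideanSpace ℝ (Fin d) → ℝ) (hpZ : HasDensity (P.map Z) pZ)
    (Xp Yr : Fin (T + 1) → Ω → EuclideanSpace ℝ (Fin d))
    (hXp : IsCondSNF P Y Xp) (hYr : IsCondReverse P X Y Xp Yr)
    (hX0 : ∀ᵐ y ∂(P.map Y), condDistrib (Xp 0) Y P y = P.map Z)
    (p : Fin (T + 1) → EuclideanSpace ℝ (Fin m) → EuclideanSpace ℝ (Fin d) → ℝ)
    (hp : ∀ t, HasCondDensity P (Xp t) Y (p t))
    (f : Fin T → EuclideanSpace ℝ (Fin m) → EuclideanSpace ℝ (Fin d) →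
      EuclideanSpace ℝ (Fin d) → ℝ)
    (hf : IsBackwardRatio P Y Xp Yr f) :
    -- the forward divergence
    (∀ (pX : EuclideanSpace ℝ (Fin d) → ℝ) (pY : EuclideanSpace ℝ (Fin m) → ℝ)
        (pYX : EuclideanSpace ℝ (Fin d) → EuclideanSpace ℝ (Fin m) → ℝ),
      HasDensity (P.map X) pX → HasDensity (P.map Y) pY → HasCondDensity P Y X pYX →
      Integrable (fun z => Real.log (pZ z)) (P.map Z) →
      Integrable (fun y => Real.log (pY y)) (P.map Y) →
      (InformationTheory.klDiv (P.map (fun ω => (Y ω, fun t => Xp t ω)))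
          (P.map (fun ω => (Y ω, fun t => Yr t ω))) : EReal) =
        eexpect (P.map Y) (fun y =>
          eexpect (condDistrib (fun ω t => Xp t ω) Y P y) (fun x =>
            ((-Real.log (pYX (x (Fin.last T)) y) - Real.log (pX (x (Fin.last T)))
              - ∑ t : Fin T, Real.log (f t y (x t.castSucc) (x t.succ)
                  * p t.castSucc y (x t.castSucc) / p t.succ y (x t.succ)) : ℝ) : EReal)))
        + (((∫ z, Real.log (pZ z) ∂(P.map Z)) + ∫ y, Real.log (pY y) ∂(P.map Y) : ℝ) : EReal)) ∧
    -- the reverse divergence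
    (∀ (pXY : EuclideanSpace ℝ (Fin m) → EuclideanSpace ℝ (Fin d) → ℝ),
      HasCondDensity P X Y pXY →
      Integrable (fun z : EuclideanSpace ℝ (Fin m) × EuclideanSpace ℝ (Fin d) =>
        Real.log (pXY z.1 z.2)) (P.map (fun ω => (Y ω, X ω))) →
      (InformationTheory.klDiv (P.map (fun ω => (Y ω, fun t => Yr t ω)))
          (P.map (fun ω => (Y ω, fun t => Xp t ω))) : EReal) =
        eexpect (P.map Y) (fun y =>
          eexpect (condDistrib (fun ω t => Yr t ω) Y P y) (fun x =>
            ((-Real.log (pZ (x 0))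
              + ∑ t : Fin T, Real.log (f t y (x t.castSucc) (x t.succ)
                  * p t.castSucc y (x t.castSucc) / p t.succ y (x t.succ)) : ℝ) : EReal)))
        + ((∫ z, Real.log (pXY z.1 z.2) ∂(P.map (fun ω => (Y ω, X ω))) : ℝ) : EReal)) ∧
    -- the likelihood is determined by the noise
    (∀ (pη : EuclideanSpace ℝ (Fin m) → ℝ)
        (pYX : EuclideanSpace ℝ (Fin d) → EuclideanSpace ℝ (Fin m) → ℝ),
      IndepFun X η P → HasDensity (P.map η) pη → HasCondDensity P Y X pYX →
      ∀ᵐ x ∂(P.map X), ∀ᵐ y ∂(volume : Measure (EuclideanSpace ℝ (Fin m))),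
        pYX x y = pη (y - F x)) := by
  refine ⟨fun pX pY pYX hpX hpY hpYX hintZ hintY => ?_, fun pXY hpXY hint => ?_,
    fun pη pYX hind hpη hpYX => ?_⟩
  · exact klDiv_forward_reverse hY hX hpZ hXp hYr hX0 hZ hp hf hpX hpY hpYX hintZ hintY
  · exact klDiv_reverse_forward hY hX hpZ hXp hYr hX0 hp hf hpXY hint
  · exact likelihood_eq_noise hX hF hη hmodel hind hpη hpYX
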